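/- Let $d\ge 2$. A convex body is a compact convex subset of $\mathbb{E}^d$ with non-empty interior; a plank $P$ is the closed set between two distinct parallel hyperplanes. For a hyperplane $H$, $w(K,H)$ denotes the distance between the two supporting hyperplanes of $K$ parallel to $H$ (with value $\infty$ if $K$ is unbounded in the direction normal to $H$). For a convex body $C$ put $w_C(K,H)=w(K,H)/w(C,H)$ and let $w_C(K)=\min_H w_C(K,H)$ be the minimal $C$-width of $K$; the $C$-width $w_C(P)$ of a plank $P$ is its width divided by the width of $C$ parallel to it. The $C$-inradius $r$ of $K$ is the largest $\rho>0$ such that a translate of $\rho C$ lies in $K$. For $0<\rho\le r$ let $K^{\rho C}$ be the union of all translates of $\rho C$ contained in $K$. For an integer $m\ge1$ the $m$-th successive $C$-inradius $r_C(K,m)$ is the unique $\rho\in(0,r]$ with $w_C(K^{\rho C})=m\rho$; the same definition is used when $K$ is a plank. If $K$ is sliced by hyperplanes $H_1,\dots,H_{n-1}$ ($n\ge 1$; the hyperplanes need not be distinct or meet $K$), the pieces are the closures of the connected components of $K\setminus\bigcup_i H_i$. **Theorem.** For each fixed $d\ge2$ the following statements about $\mathbb{E}^d$ are equivalent (hence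 so are the conjectures asserting them for all $d\ge2$): 1. If a convex body $C$ is covered by planks $P_1,\dots,P_n$, then $\sum_{i=1}^n w_C(P_i)\ge 1$. 2. If a convex body $C$ is sliced by $n-1$ hyperplanes, then some piece contains a translate of $\frac1n C$. 3. If a convex body $K$ is covered by planks $P_1,\dots,P_n$, then $\sum_{i=1}^n w_C(P_i)\ge w_C(K)$ for every convex body $C$. 4. For all convex bodies $K,C$ and all $n\ge1$, the minimum, over all ways to slice $K$ by $n-1$ hyperplanes, of the greatest $C$-inradius of the pieces is equal to $r_C(K,n)$. 5. For every $m\ge1$, $(5_m)$ holds, where $(5_m)$ says: if $K,C$ are convex bodies and $K$ is covered by planks $P_1,\dots,P_n$, then $\sum_{i=1}^n r_C(P_i,m)\ge r_C(K,m)$. 6. For every $m\ge1$, $(6_m)$ holds, where $(6_m)$ says: if $K,C$ are convex bodies and $K$ is covered by planks $P_1,\dots,P_n$, then $\sum_{i=1}^n w_C(P_i)\ge m\,r_C(K,m)$. 7. For every $m\ge1$, $(7_m)$ holds, where $(7_m)$ says: for all convex bodies $K,C$ and all $n\ge1$, the minimum, over all ways to slice $K$ by $n-1$ hyperplanes, of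 the greatest $m$-th successive $C$-inradius of the pieces is equal to $r_C(K,mn)$. Moreover, for every single $m\ge1$, $(5_m)$ and $(6_m)$ are equivalent, and $(5_m)$ implies $(7_m)$. -/

import Mathlib

open scoped ENNReal Pointwise

namespace PlankInradii

/-- Euclidean `d`-space. -/
abbrev E (d : ℕ) : Type := EuclideanSpace ℝ (Fin d)

/-- A convex body: a compact convex set with non-empty interior. -/
structure IsConvexBody {d : ℕ} (K : Set (E d)) : Prop where
  convex : Convex ℝ K
  isCompact : IsCompact K
  interior_nonempty : (interior K).Nonempty

/-- For a unit vector `u`, the width of `K` parallel to the hyperplanes with normal `u`: the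
length of the projection of `K` to the line spanned by `u`, i.e. the distance between the two
supporting hyperplanes of `K` with normal `u` (infinite if `K` is unbounded in direction `u`). -/
noncomputable def width {d : ℕ} (K : Set (E d)) (u : E d) : ℝ≥0∞ :=
  ⨆ x ∈ K, ⨆ y ∈ K, ENNReal.ofReal (inner ℝ u x - inner ℝ u y)

/-- The `C`-width of `K` parallel to the hyperplanes with unit normal `u`. -/
noncomputable def relWidth {d : ℕ} (C K : Set (E d)) (u : E d) : ℝ≥0∞ :=
  width K u / width C u

/-- The minimal `C`-width `w_C(K)` of `K`. -/
noncomputable def minRelWidth {d : ℕ} (C K : Set (E d)) : ℝ≥0∞ :=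
  ⨅ u : Metric.sphere (0 : E d) 1, relWidth C K u

/-- The `C`-inradius of `K`: the factor of the largest positive homothetic copy of `C`, a
translate of which is contained in `K`. -/
noncomputable def inradius {d : ℕ} (C K : Set (E d)) : ℝ :=
  sSup {ρ : ℝ | 0 < ρ ∧ ∃ t : E d, t +ᵥ ρ • C ⊆ K}

/-- The `ρC`-rounded body of `K`: the union of all translates of `ρC` contained in `K`. -/
def roundedBody {d : ℕ} (C K : Set (E d)) (ρ : ℝ) : Set (E d) :=
  ⋃ t ∈ {t : E d | t +ᵥ ρ • C ⊆ K}, t +ᵥ ρ • C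

/-- The `m`-th successive `C`-inradius `r_C(K, m)`: the `ρ` with `0 < ρ ≤ r`, `r` the
`C`-inradius of `K`, such that the minimal `C`-width of the `ρC`-rounded body is `m ρ`.
For convex bodies (and for planks) `K`, a convex body `C` and `m ≥ 1` there is exactly one such
`ρ`, so the supremum is that of a one-point set. -/
noncomputable def succInradius {d : ℕ} (C K : Set (E d)) (m : ℕ) : ℝ :=
  sSup {ρ : ℝ | 0 < ρ ∧ ρ ≤ inradius C K ∧
    minRelWidth C (roundedBody C K ρ) = ENNReal.ofReal ((m : ℝ) * ρ)}

/-- A plank, given by a unit normal and the two distinct levels of its boundary hyperplanes. -/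
structure Plank (d : ℕ) where
  normal : E d
  norm_normal : ‖normal‖ = 1
  lo : ℝ
  hi : ℝ
  lo_lt_hi : lo < hi

/-- The closed set of points of a plank. -/
def Plank.carrier {d : ℕ} (P : Plank d) : Set (E d) :=
  {x | P.lo ≤ inner ℝ P.normal x ∧ inner ℝ P.normal x ≤ P.hi}

/-- The `C`-width of a plank: its width divided by the width of `C` parallel to it. -/
noncomputable def Plank.relWidth {d : ℕ} (C : Set (E d)) (P : Plank d) : ℝ≥0∞ :=
  ENNReal.ofReal (P.hi - P.lo) / width C P.normal

/-- The hyperplane `{x | ⟪normal, x⟫ = offset}`. -/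
structure Hyperplane (d : ℕ) where
  normal : E d
  norm_normal : ‖normal‖ = 1
  offset : ℝ

/-- `Q` is one of the pieces into which the hyperplanes `H i` slice `K`: for some point `x` of `K`
that lies on none of the hyperplanes, `Q` consists of the points of `K` that lie, for each `i`, in
the same closed half-space of `H i` as `x`. -/
def IsPiece {d k : ℕ} (K : Set (E d)) (H : Fin k → Hyperplane d) (Q : Set (E d)) : Prop :=
  ∃ x ∈ K, (∀ i, inner ℝ (H i).normal x ≠ (H i).offset) ∧
    Q = {y ∈ K | ∀ i, 0 ≤ (inner ℝ (H i).normal x - (H i).offset) *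
      (inner ℝ (H i).normal y - (H i).offset)}

/-- Bang's affine plank conjecture in `E d`. -/
def BangConjecture (d : ℕ) : Prop :=
  ∀ C : Set (E d), IsConvexBody C →
    ∀ (n : ℕ) (P : Fin n → Plank d), C ⊆ ⋃ i, (P i).carrier →
      1 ≤ ∑ i, (P i).relWidth C

/-- The Alexander--Davenport conjecture in `E d`: if a convex body `C` is sliced by `n - 1`
hyperplanes, then some piece covers a translate of `(1 / n) C`. -/
def AlexanderDavenportConjecture (d : ℕ) : Prop :=
  ∀ C : Set (E d), IsConvexBody C →
    ∀ n : ℕ, 1 ≤ n → ∀ H : Fin (n - 1) → Hyperplane d,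
      ∃ Q, IsPiece C H Q ∧ ∃ t : E d, t +ᵥ (1 / (n : ℝ)) • C ⊆ Q

/-- The plank version with two bodies in `E d`. -/
def BodyPlankConjecture (d : ℕ) : Prop :=
  ∀ K : Set (E d), IsConvexBody K →
    ∀ (n : ℕ) (P : Fin n → Plank d), K ⊆ ⋃ i, (P i).carrier →
      ∀ C : Set (E d), IsConvexBody C → minRelWidth C K ≤ ∑ i, (P i).relWidth C

/-- The cutting version with two bodies in `E d`: the minimum, over all ways to slice `K` by `n - 1`
hyperplanes, of the greatest `C`-inradius of the pieces is `r_C(K, n)`. -/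
def BodyCutConjecture (d : ℕ) : Prop :=
  ∀ K C : Set (E d), IsConvexBody K → IsConvexBody C → ∀ n : ℕ, 1 ≤ n →
    IsLeast {ρ : ℝ | ∃ H : Fin (n - 1) → Hyperplane d,
        IsGreatest {r : ℝ | ∃ Q, IsPiece K H Q ∧ r = inradius C Q} ρ}
      (succInradius C K n)

/-- The plank version for `m`-th successive inradii in `E d`. -/
def SuccPlankConjecture (d m : ℕ) : Prop :=
  ∀ K C : Set (E d), IsConvexBody K → IsConvexBody C →
    ∀ (n : ℕ) (P : Fin n → Plank d), K ⊆ ⋃ i, (P i).carrier →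
      succInradius C K m ≤ ∑ i, succInradius C (P i).carrier m

/-- The plank version for `m`-th successive inradii in `E d`, phrased with `C`-widths of planks. -/
def SuccPlankWidthConjecture (d m : ℕ) : Prop :=
  ∀ K C : Set (E d), IsConvexBody K → IsConvexBody C →
    ∀ (n : ℕ) (P : Fin n → Plank d), K ⊆ ⋃ i, (P i).carrier →
      ENNReal.ofReal ((m : ℝ) * succInradius C K m) ≤ ∑ i, (P i).relWidth C

/-- The cutting version for `m`-th successive inradii in `E d`: the minimum, over all ways to slice
`K` by `n - 1` hyperplanes, of the greatest `m`-th successive `C`-inradius of the pieces is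
`r_C(K, m n)`. -/
def SuccCutConjecture (d m : ℕ) : Prop :=
  ∀ K C : Set (E d), IsConvexBody K → IsConvexBody C → ∀ n : ℕ, 1 ≤ n →
    IsLeast {ρ : ℝ | ∃ H : Fin (n - 1) → Hyperplane d,
        IsGreatest {r : ℝ | ∃ Q, IsPiece K H Q ∧ r = succInradius C Q m} ρ}
      (succInradius C K (m * n))

end PlankInradii

/-!
The successive inradius `r_C(K, m)` is the greatest `ρ` for which the `ρC`-rounded body of `K` has
minimal `C`-width at least `m ρ`. For a plank `P` this gives `r_C(P, m) = w_C(P) / m`, whence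
`(5_m) ↔ (6_m)`. Bang's conjecture for `K` itself, with the widths rescaled to `C`, yields the
version with two bodies; applied to the `r_C(K, m)C`-rounded body of `K`, this is `(6_m)`, and
`(6_m)` for `K = C` is Bang's conjecture again, since `r_C(C, m) ≥ 1 / m`.

For the cutting versions let `T` be the set of centers of the translates of `sC` contained in `K`,
where `s < r_C(K, mn)`. The `C`-width of `T` exceeds `(mn - 1) s`, so for
`l = (m - 1) / (mn - 1)` the body `lT + sC` meets each of the `n - 1` hyperplanes only when its
translation vector lies in a plank that takes up less than `1 / (n - 1)` of the width of `(1 - l)T`.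
By Bang's conjecture some translation vector in `(1 - l)T` avoids all these planks, and the piece
containing the corresponding translate has `m`-th successive inradius at least `s`. Equidistant
hyperplanes across the minimal width of the rounded body show that `r_C(K, mn)` is attained.

Conversely, every cutting version provides a piece of minimal `C`-width at least `1 / n`, and that
is enough for Bang's conjecture: planks covering `C` of total `C`-width less than `1` could be cut
by fewer than `N` parallel hyperplanes at distances less than `1 / N` of the width of `C`, for a
large `N`, and no piece of minimal `C`-width `1 / N` could then meet any of the planks.
-/

namespace PlankInradii

section InnerProductSpace

variable {V : Type*} [NormedAddCommGroup V] [InnerProductSpace ℝ V] {K L : Set V}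

theorem exists_inner_eq_zero_and_inner_ne_zero {u v : V} (hv : v ∉ Submodule.span ℝ {u}) :
    ∃ z : V, inner ℝ u z = 0 ∧ inner ℝ v z ≠ 0 := by
  by_contra! h
  refine hv ?_
  rw [← Submodule.orthogonal_orthogonal (Submodule.span ℝ {u}), Submodule.mem_orthogonal]
  intro z hz
  rw [real_inner_comm]
  exact h z (Submodule.mem_orthogonal_singleton_iff_inner_right.1 hz)

/-- The width of `K` in the direction `u` as a real number. It is used only for nonempty compact
sets, where the supremum is attained. -/
noncomputable def realWidth (K : Set V) (u : V) : ℝ :=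
  sSup ((fun p : V × V => inner ℝ u p.1 - inner ℝ u p.2) '' (K ×ˢ K))

theorem exists_realWidth_eq (hK : IsCompact K) (hne : K.Nonempty) (u : V) :
    ∃ a ∈ K, ∃ b ∈ K, (∀ x ∈ K, inner ℝ u a ≤ inner ℝ u x ∧ inner ℝ u x ≤ inner ℝ u b) ∧
      realWidth K u = inner ℝ u b - inner ℝ u a := by
  have hc : ContinuousOn (fun x : V => (inner ℝ u x : ℝ)) K := by fun_prop
  obtain ⟨a, ha, ha'⟩ := hK.exists_isMinOn hne hc
  obtain ⟨b, hb, hb'⟩ := hK.exists_isMaxOn hne hc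
  refine ⟨a, ha, b, hb, fun x hx => ⟨ha' hx, hb' hx⟩, ?_⟩
  refine IsGreatest.csSup_eq ⟨⟨(b, a), ⟨hb, ha⟩, rfl⟩, ?_⟩
  rintro _ ⟨⟨x, y⟩, ⟨hx, hy⟩, rfl⟩
  exact sub_le_sub (hb' hx) (ha' hy)

theorem inner_sub_inner_le_realWidth (hK : IsCompact K) (u : V) {x y : V} (hx : x ∈ K)
    (hy : y ∈ K) : inner ℝ u x - inner ℝ u y ≤ realWidth K u := by
  obtain ⟨a, -, b, -, h, e⟩ := exists_realWidth_eq hK ⟨x, hx⟩ u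
  rw [e]
  exact sub_le_sub (h x hx).2 (h y hy).1

theorem realWidth_nonneg (hK : IsCompact K) (hne : K.Nonempty) (u : V) : 0 ≤ realWidth K u := by
  obtain ⟨x, hx⟩ := hne
  simpa using inner_sub_inner_le_realWidth hK u hx hx

theorem continuous_realWidth (hK : IsCompact K) : Continuous (realWidth K) := by
  refine (hK.prod hK).continuous_sSup
    (f := fun (u : V) (p : V × V) => inner ℝ u p.1 - inner ℝ u p.2) ?_
  simp only [Function.HasUncurry.uncurry, id]
  fun_prop

theorem realWidth_add (hK : IsCompact K) (hL : IsCompact L) (hKne : K.Nonempty)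
    (hLne : L.Nonempty) (u : V) : realWidth (K + L) u = realWidth K u + realWidth L u := by
  obtain ⟨a, ha, b, hb, h, e⟩ := exists_realWidth_eq hK hKne u
  obtain ⟨a', ha', b', hb', h', e'⟩ := exists_realWidth_eq hL hLne u
  refine IsGreatest.csSup_eq ⟨⟨(b + b', a + a'),
    ⟨Set.add_mem_add hb hb', Set.add_mem_add ha ha'⟩, ?_⟩, ?_⟩
  · simp only [inner_add_right, e, e']
    ring
  · rintro _ ⟨⟨x, y⟩, ⟨⟨x1, hx1, x2, hx2, rfl⟩, ⟨y1, hy1, y2, hy2, rfl⟩⟩, rfl⟩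
    simp only [inner_add_right, e, e']
    linarith [(h x1 hx1).2, (h' x2 hx2).2, (h y1 hy1).1, (h' y2 hy2).1]

theorem realWidth_smul (hK : IsCompact K) (hne : K.Nonempty) {r : ℝ} (hr : 0 ≤ r) (u : V) :
    realWidth (r • K) u = r * realWidth K u := by
  obtain ⟨a, ha, b, hb, h, e⟩ := exists_realWidth_eq hK hne u
  refine IsGreatest.csSup_eq ⟨⟨(r • b, r • a),
    ⟨Set.smul_mem_smul_set hb, Set.smul_mem_smul_set ha⟩, ?_⟩, ?_⟩
  · simp only [real_inner_smul_right, e]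
    ring
  · rintro _ ⟨⟨x, y⟩, ⟨⟨x, hx, rfl⟩, ⟨y, hy, rfl⟩⟩, rfl⟩
    simp only [real_inner_smul_right, e]
    rw [← mul_sub]
    exact mul_le_mul_of_nonneg_left (sub_le_sub (h x hx).2 (h y hy).1) hr

theorem mul_realWidth_le_of_vadd_smul_subset (hK : IsCompact K) (hne : K.Nonempty)
    (hL : IsCompact L) {t : V} {r : ℝ} (hsub : t +ᵥ r • K ⊆ L) (u : V) :
    r * realWidth K u ≤ realWidth L u := by
  obtain ⟨a, ha, b, hb, -, e⟩ := exists_realWidth_eq hK hne u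
  have hmem : ∀ x ∈ K, t + r • x ∈ L := fun x hx =>
    hsub (Set.vadd_mem_vadd_set (Set.smul_mem_smul_set hx))
  have h := inner_sub_inner_le_realWidth hL u (hmem b hb) (hmem a ha)
  rw [inner_add_right, inner_add_right, real_inner_smul_right, real_inner_smul_right] at h
  rw [e]
  linarith

theorem realWidth_pos (hK : IsCompact K) (hint : (interior K).Nonempty) {u : V} (hu : ‖u‖ = 1) :
    0 < realWidth K u := by
  obtain ⟨x, hx⟩ := hint
  obtain ⟨ε, hε, h⟩ := Metric.isOpen_iff.1 isOpen_interior x hx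
  have hmem : x + (ε / 2) • u ∈ K := by
    refine interior_subset (h ?_)
    rw [Metric.mem_ball, dist_eq_norm, add_sub_cancel_left, norm_smul, hu, mul_one,
      Real.norm_of_nonneg (by positivity)]
    exact half_lt_self hε
  have := inner_sub_inner_le_realWidth hK u hmem (interior_subset hx)
  rw [inner_add_right, real_inner_smul_right, real_inner_self_eq_norm_sq, hu] at this
  linarith

theorem interior_nonempty_of_realWidth_pos [FiniteDimensional ℝ V] (hc : Convex ℝ K)
    (hK : IsCompact K) (hne : K.Nonempty) (h : ∀ u : V, ‖u‖ = 1 → 0 < realWidth K u) :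
    (interior K).Nonempty := by
  rw [hc.interior_nonempty_iff_affineSpan_eq_top,
    ← AffineSubspace.direction_eq_top_iff_of_nonempty (hne.mono (subset_affineSpan ℝ K)),
    ← Submodule.orthogonal_eq_bot_iff]
  by_contra hD
  obtain ⟨w, hw, hw0⟩ := Submodule.exists_mem_ne_zero_of_ne_bot hD
  have hu : ‖(‖w‖⁻¹ • w)‖ = 1 := norm_smul_inv_norm hw0
  obtain ⟨a, ha, b, hb, -, e⟩ := exists_realWidth_eq hK hne (‖w‖⁻¹ • w)
  have hba : b - a ∈ (affineSpan ℝ K).direction := AffineSubspace.vsub_mem_direction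
    (subset_affineSpan ℝ K hb) (subset_affineSpan ℝ K ha)
  have hpos := h _ hu
  rw [e, ← inner_sub_right, real_inner_smul_left, Submodule.inner_left_of_mem_orthogonal hba hw,
    mul_zero] at hpos
  exact lt_irrefl _ hpos

theorem isCompact_setOf_le_realWidth_section {X : Type*} [TopologicalSpace X] [T2Space X]
    {G : Set (X × V)} (hG : IsCompact G) {f : X → ℝ} (hf : Continuous f) (u : V) :
    IsCompact {x | (∃ v, (x, v) ∈ G) ∧ f x ≤ realWidth {v | (x, v) ∈ G} u} := by
  have heq : IsClosed {p : (X × V) × (X × V) | p.1.1 = p.2.1} :=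
    isClosed_eq (by fun_prop) (by fun_prop)
  have hle : IsClosed {p : (X × V) × (X × V) |
      f p.1.1 ≤ inner ℝ u p.1.2 - inner ℝ u p.2.2} :=
    isClosed_le (by fun_prop) (by fun_prop)
  have hsection : ∀ x, IsCompact {v | (x, v) ∈ G} := fun x => by
    refine (hG.image continuous_snd).of_isClosed_subset
      (hG.isClosed.preimage (by fun_prop : Continuous fun v : V => (x, v))) ?_
    exact fun v hv => ⟨(x, v), hv, rfl⟩
  convert ((hG.prod hG).inter_right (heq.inter hle)).image
    (continuous_fst.comp continuous_fst) using 1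
  ext x
  constructor
  · rintro ⟨hne, h⟩
    obtain ⟨a, ha, b, hb, -, e⟩ := exists_realWidth_eq (hsection x) hne u
    exact ⟨((x, b), (x, a)), ⟨⟨hb, ha⟩, rfl, h.trans_eq e⟩, rfl⟩
  · rintro ⟨⟨⟨x, b⟩, ⟨x', a⟩⟩, ⟨⟨hb, ha⟩, hx, h⟩, rfl⟩
    obtain rfl : x = x' := hx
    exact ⟨⟨b, hb⟩, h.trans (inner_sub_inner_le_realWidth (hsection x) u hb ha)⟩

end InnerProductSpace

section Centers

variable {V : Type*} [AddCommGroup V] [Module ℝ V] {C K L : Set V} {ρ σ : ℝ} {t : V}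

/-- The translation vectors that carry `ρ • C` into `K`. -/
def centers (C K : Set V) (ρ : ℝ) : Set V :=
  {t | t +ᵥ ρ • C ⊆ K}

theorem mem_centers : t ∈ centers C K ρ ↔ ∀ c ∈ C, t + ρ • c ∈ K := by
  constructor
  · intro h c hc
    exact h (Set.vadd_mem_vadd_set (Set.smul_mem_smul_set hc))
  · rintro h _ ⟨_, ⟨c, hc, rfl⟩, rfl⟩
    exact h c hc

theorem subset_centers_iff {A : Set V} : A ⊆ centers C K ρ ↔ A + ρ • C ⊆ K := by
  rw [Set.add_subset_iff]
  refine forall₂_congr fun t _ => ?_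
  rw [← Set.image_smul, Set.forall_mem_image, mem_centers]

theorem centers_mono (h : K ⊆ L) (ρ : ℝ) : centers C K ρ ⊆ centers C L ρ :=
  fun _ ht => ht.trans h

theorem smul_add_smul_mem_centers (hK : Convex ℝ K) {t' : V} (ht : t ∈ centers C K ρ)
    (ht' : t' ∈ centers C K σ) {a b : ℝ} (ha : 0 ≤ a) (hb : 0 ≤ b) (hab : a + b = 1) :
    a • t + b • t' ∈ centers C K (a * ρ + b * σ) := by
  rw [mem_centers] at *
  intro c hc
  convert hK (ht c hc) (ht' c hc) ha hb hab using 1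
  module

theorem convex_centers (C : Set V) (hK : Convex ℝ K) (ρ : ℝ) : Convex ℝ (centers C K ρ) := by
  intro t ht t' ht' a b ha hb hab
  have := smul_add_smul_mem_centers hK ht ht' ha hb hab
  rwa [← add_mul, hab, one_mul] at this

theorem centers_centers_subset : centers C (centers C K ρ) σ ⊆ centers C K (ρ + σ) := by
  intro t ht
  rw [mem_centers] at ht ⊢
  intro c hc
  convert mem_centers.1 (ht c hc) c hc using 1
  module

theorem add_smul_mem_centers (hC : Convex ℝ C) (hρ : 0 ≤ ρ) (h : ρ ≤ σ)
    (ht : t ∈ centers C K σ) {c : V} (hc : c ∈ C) : t + (σ - ρ) • c ∈ centers C K ρ := by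
  rw [mem_centers] at ht ⊢
  intro c' hc'
  have hmem : (σ - ρ) • c + ρ • c' ∈ σ • C := by
    rw [← sub_add_cancel σ ρ, hC.add_smul (sub_nonneg.2 h) hρ, add_sub_cancel_right]
    exact Set.add_mem_add (Set.smul_mem_smul_set hc) (Set.smul_mem_smul_set hc')
  obtain ⟨c'', hc'', e⟩ := hmem
  rw [add_assoc, ← e]
  exact ht c'' hc''

theorem centers_nonempty_anti (hC : Convex ℝ C) (hne : C.Nonempty) (hρ : 0 ≤ ρ) (h : ρ ≤ σ)
    (hσ : (centers C K σ).Nonempty) : (centers C K ρ).Nonempty :=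
  ⟨_, add_smul_mem_centers hC hρ h hσ.some_mem hne.some_mem⟩

end Centers

section CentersTopology

variable {V : Type*} [NormedAddCommGroup V] [NormedSpace ℝ V] {C K : Set V}

theorem isClosed_centers_graph (C : Set V) (hK : IsClosed K) :
    IsClosed {p : ℝ × V | p.2 ∈ centers C K p.1} := by
  have : {p : ℝ × V | p.2 ∈ centers C K p.1} =
      ⋂ c ∈ C, (fun p : ℝ × V => p.2 + p.1 • c) ⁻¹' K := by
    ext p
    simp only [Set.mem_ofPred_eq, mem_centers, Set.mem_iInter₂, Set.mem_preimage]
  rw [this]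
  exact isClosed_biInter fun c _ => hK.preimage (by fun_prop)

/-- Two points `a ≠ b` of `C` recover `p = (ρ, t)` from the points `t + ρ • a`, `t + ρ • b` of the
compact set `K`. -/
theorem isCompact_centers_graph (hC : C.Nontrivial) (hK : IsCompact K) :
    IsCompact {p : ℝ × V | 0 ≤ p.1 ∧ p.2 ∈ centers C K p.1} := by
  obtain ⟨a, ha, b, hb, hab⟩ := hC
  have hab' : ‖a - b‖ ≠ 0 := norm_ne_zero_iff.2 (sub_ne_zero.2 hab)
  have hcont : Continuous fun q : V × V =>
      (‖q.1 - q.2‖ / ‖a - b‖, q.1 - (‖q.1 - q.2‖ / ‖a - b‖) • a) := by fun_prop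
  refine ((hK.prod hK).image hcont).of_isClosed_subset
    ((isClosed_le continuous_const continuous_fst).inter
      (isClosed_centers_graph C hK.isClosed)) ?_
  rintro ⟨ρ, t⟩ ⟨hρ, ht⟩
  have hρ' : ‖(t + ρ • a) - (t + ρ • b)‖ / ‖a - b‖ = ρ := by
    rw [add_sub_add_left_eq_sub, ← smul_sub, norm_smul, mul_div_cancel_right₀ _ hab',
      Real.norm_of_nonneg hρ]
  refine ⟨(t + ρ • a, t + ρ • b), ⟨mem_centers.1 ht a ha, mem_centers.1 ht b hb⟩, ?_⟩
  simp only [hρ', add_sub_cancel_right]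

theorem isCompact_centers (hC : C.Nonempty) (hK : IsCompact K) (ρ : ℝ) :
    IsCompact (centers C K ρ) := by
  obtain ⟨c, hc⟩ := hC
  refine (hK.image (continuous_sub_right (ρ • c))).of_isClosed_subset
    ((isClosed_centers_graph C hK.isClosed).preimage
      (by fun_prop : Continuous fun t : V => (ρ, t))) fun t ht => ?_
  exact ⟨_, mem_centers.1 ht c hc, add_sub_cancel_right _ _⟩

theorem bddAbove_centers_nonempty (hC : C.Nontrivial) (hK : IsCompact K) :
    BddAbove {ρ : ℝ | 0 ≤ ρ ∧ (centers C K ρ).Nonempty} := by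
  refine ((isCompact_centers_graph hC hK).image continuous_fst).bddAbove.mono ?_
  rintro ρ ⟨hρ, t, ht⟩
  exact ⟨(ρ, t), ⟨hρ, ht⟩, rfl⟩

end CentersTopology

variable {d : ℕ} {C K L Q : Set (E d)} {u : E d} {ρ σ s : ℝ}

namespace IsConvexBody

theorem nonempty (hK : IsConvexBody K) : K.Nonempty :=
  hK.interior_nonempty.mono interior_subset

theorem realWidth_pos (hK : IsConvexBody K) (hu : ‖u‖ = 1) : 0 < realWidth K u :=
  PlankInradii.realWidth_pos hK.isCompact hK.interior_nonempty hu

theorem nontrivial [Nontrivial (E d)] (hK : IsConvexBody K) : K.Nontrivial := by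
  obtain ⟨u, hu⟩ := exists_norm_eq (E d) zero_le_one
  obtain ⟨a, ha, b, hb, -, e⟩ := exists_realWidth_eq hK.isCompact hK.nonempty u
  refine ⟨a, ha, b, hb, ?_⟩
  rintro rfl
  exact (hK.realWidth_pos hu).ne' (e.trans (sub_self _))

theorem of_subset (hL : IsConvexBody L) (hK : Convex ℝ K) (hKc : IsCompact K) (h : L ⊆ K) :
    IsConvexBody K :=
  ⟨hK, hKc, hL.interior_nonempty.mono (interior_mono h)⟩

theorem smul (hK : IsConvexBody K) {r : ℝ} (hr : 0 < r) : IsConvexBody (r • K) := by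
  refine ⟨hK.convex.smul r, hK.isCompact.smul r, ?_⟩
  rw [interior_smul₀ hr.ne']
  exact hK.interior_nonempty.smul_set

theorem vadd (hK : IsConvexBody K) (t : E d) : IsConvexBody (t +ᵥ K) := by
  refine ⟨hK.convex.vadd t, hK.isCompact.vadd t, ?_⟩
  rw [interior_vadd]
  exact hK.interior_nonempty.vadd_set

theorem exists_mem_centers (hK : IsConvexBody K) (hC : IsCompact C) :
    ∃ r : ℝ, 0 < r ∧ ∃ t, t ∈ centers C K r := by
  obtain ⟨x, hx⟩ := hK.interior_nonempty
  obtain ⟨ε, hε, h⟩ := Metric.isOpen_iff.1 isOpen_interior x hx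
  obtain ⟨R, hR, hCR⟩ := hC.isBounded.exists_pos_norm_le
  refine ⟨ε / (2 * R), by positivity, x, mem_centers.2 fun c hc => interior_subset (h ?_)⟩
  rw [Metric.mem_ball, dist_eq_norm, add_sub_cancel_left, norm_smul,
    Real.norm_of_nonneg (by positivity)]
  calc ε / (2 * R) * ‖c‖ ≤ ε / (2 * R) * R := by gcongr; exact hCR c hc
    _ = ε / 2 := by field_simp
    _ < ε := half_lt_self hε

end IsConvexBody

theorem width_mono (h : K ⊆ L) (u : E d) : width K u ≤ width L u :=
  iSup₂_le fun x hx => iSup₂_le fun y hy => le_iSup₂_of_le x (h hx) (le_iSup₂_of_le y (h hy) le_rfl)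

theorem width_neg (K : Set (E d)) (u : E d) : width K (-u) = width K u := by
  simp only [width, inner_neg_left, neg_sub_neg]
  exact iSup₂_comm _

theorem width_eq_ofReal (hK : IsCompact K) (hne : K.Nonempty) (u : E d) :
    width K u = ENNReal.ofReal (realWidth K u) := by
  apply le_antisymm
  · refine iSup₂_le fun x hx => iSup₂_le fun y hy => ?_
    exact ENNReal.ofReal_le_ofReal (inner_sub_inner_le_realWidth hK u hx hy)
  · obtain ⟨a, ha, b, hb, -, e⟩ := exists_realWidth_eq hK hne u
    rw [e]
    exact le_iSup₂_of_le b hb (le_iSup₂_of_le a ha le_rfl)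

theorem IsConvexBody.width_ne_top (hK : IsConvexBody K) (u : E d) : width K u ≠ ∞ := by
  rw [width_eq_ofReal hK.isCompact hK.nonempty]
  exact ENNReal.ofReal_ne_top

theorem IsConvexBody.width_ne_zero (hK : IsConvexBody K) (hu : ‖u‖ = 1) : width K u ≠ 0 := by
  rw [width_eq_ofReal hK.isCompact hK.nonempty, ne_eq, ENNReal.ofReal_eq_zero, not_le]
  exact hK.realWidth_pos hu

theorem relWidth_eq_ofReal (hC : IsConvexBody C) (hK : IsCompact K) (hne : K.Nonempty)
    (hu : ‖u‖ = 1) : relWidth C K u = ENNReal.ofReal (realWidth K u / realWidth C u) := by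
  rw [relWidth, width_eq_ofReal hK hne, width_eq_ofReal hC.isCompact hC.nonempty,
    ENNReal.ofReal_div_of_pos (hC.realWidth_pos hu)]

theorem minRelWidth_le (C K : Set (E d)) (hu : ‖u‖ = 1) : minRelWidth C K ≤ relWidth C K u :=
  iInf_le (fun v : Metric.sphere (0 : E d) 1 => relWidth C K v) ⟨u, mem_sphere_zero_iff_norm.2 hu⟩

theorem le_minRelWidth_iff {c : ℝ≥0∞} :
    c ≤ minRelWidth C K ↔ ∀ u : E d, ‖u‖ = 1 → c ≤ relWidth C K u := by
  simp only [minRelWidth, le_iInf_iff, Subtype.forall, mem_sphere_zero_iff_norm]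

theorem minRelWidth_mono (C : Set (E d)) (h : K ⊆ L) : minRelWidth C K ≤ minRelWidth C L :=
  iInf_mono fun u => ENNReal.div_le_div_right (width_mono h u) _

theorem ofReal_le_minRelWidth_iff (hC : IsConvexBody C) (hK : IsCompact K) (hne : K.Nonempty)
    {q : ℝ} : ENNReal.ofReal q ≤ minRelWidth C K ↔
      ∀ u : E d, ‖u‖ = 1 → q * realWidth C u ≤ realWidth K u := by
  rw [le_minRelWidth_iff]
  refine forall₂_congr fun u hu => ?_
  rw [relWidth_eq_ofReal hC hK hne hu, ENNReal.ofReal_le_ofReal_iff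
    (div_nonneg (realWidth_nonneg hK hne u) (hC.realWidth_pos hu).le),
    le_div_iff₀ (hC.realWidth_pos hu)]

theorem ofReal_le_minRelWidth_of_mem_centers (hC : IsConvexBody C) (hK : IsCompact K) {t : E d}
    (ht : t ∈ centers C K ρ) : ENNReal.ofReal ρ ≤ minRelWidth C K :=
  (ofReal_le_minRelWidth_iff hC hK ((hC.nonempty.smul_set.vadd_set).mono ht)).2 fun u _ =>
    mul_realWidth_le_of_vadd_smul_subset hC.isCompact hC.nonempty hK ht u

theorem exists_relWidth_eq_minRelWidth [Nontrivial (E d)] (hC : IsConvexBody C)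
    (hK : IsCompact K) (hne : K.Nonempty) :
    ∃ u : E d, ‖u‖ = 1 ∧ relWidth C K u = minRelWidth C K := by
  obtain ⟨u, hu, hmin⟩ := (isCompact_sphere (0 : E d) 1).exists_isMinOn
    (f := fun u => realWidth K u / realWidth C u) (NormedSpace.sphere_nonempty.2 zero_le_one)
    ((continuous_realWidth hK).continuousOn.div (continuous_realWidth hC.isCompact).continuousOn
      fun u hu => (hC.realWidth_pos (mem_sphere_zero_iff_norm.1 hu)).ne')
  have hu' : ‖u‖ = 1 := mem_sphere_zero_iff_norm.1 hu
  refine ⟨u, hu', le_antisymm (le_minRelWidth_iff.2 fun v hv => ?_) (minRelWidth_le C K hu')⟩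
  rw [relWidth_eq_ofReal hC hK hne hu', relWidth_eq_ofReal hC hK hne hv]
  exact ENNReal.ofReal_le_ofReal (hmin (mem_sphere_zero_iff_norm.2 hv))

theorem roundedBody_eq_add (C K : Set (E d)) (ρ : ℝ) :
    roundedBody C K ρ = centers C K ρ + ρ • C :=
  Set.iUnion_vadd_set _ _

theorem mem_roundedBody {x : E d} :
    x ∈ roundedBody C K ρ ↔ ∃ t ∈ centers C K ρ, ∃ c ∈ C, t + ρ • c = x := by
  simp only [roundedBody_eq_add, Set.mem_add, Set.mem_smul_set, exists_exists_and_eq_and]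

theorem roundedBody_subset (C K : Set (E d)) (ρ : ℝ) : roundedBody C K ρ ⊆ K :=
  Set.iUnion₂_subset fun _ ht => ht

theorem roundedBody_mono (C : Set (E d)) (h : K ⊆ L) (ρ : ℝ) :
    roundedBody C K ρ ⊆ roundedBody C L ρ := by
  simp only [roundedBody_eq_add]
  exact Set.add_subset_add_right (centers_mono h ρ)

theorem roundedBody_anti (hC : Convex ℝ C) (K : Set (E d)) (hρ : 0 ≤ ρ) (h : ρ ≤ σ) :
    roundedBody C K σ ⊆ roundedBody C K ρ := by
  intro x hx
  obtain ⟨t, ht, c, hc, rfl⟩ := mem_roundedBody.1 hx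
  refine mem_roundedBody.2 ⟨_, add_smul_mem_centers hC hρ h ht hc, c, hc, ?_⟩
  rw [add_assoc, ← add_smul, sub_add_cancel]

theorem roundedBody_nonempty (hC : C.Nonempty) (h : (centers C K ρ).Nonempty) :
    (roundedBody C K ρ).Nonempty := by
  rw [roundedBody_eq_add]
  exact h.add hC.smul_set

theorem mem_centers_roundedBody {t : E d} (ht : t ∈ centers C K ρ) :
    t ∈ centers C (roundedBody C K ρ) ρ :=
  Set.subset_biUnion_of_mem (u := fun t : E d => t +ᵥ ρ • C) ht

theorem smul_add_smul_mem_roundedBody (hC : Convex ℝ C) (hK : Convex ℝ K) (hρ : 0 ≤ ρ)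
    (hσ : 0 ≤ σ) {x y : E d} (hx : x ∈ roundedBody C K ρ) (hy : y ∈ roundedBody C K σ) {a b : ℝ}
    (ha : 0 ≤ a) (hb : 0 ≤ b) (hab : a + b = 1) :
    a • x + b • y ∈ roundedBody C K (a * ρ + b * σ) := by
  obtain ⟨t, ht, c, hc, rfl⟩ := mem_roundedBody.1 hx
  obtain ⟨t', ht', c', hc', rfl⟩ := mem_roundedBody.1 hy
  rw [roundedBody_eq_add, hC.add_smul (mul_nonneg ha hρ) (mul_nonneg hb hσ)]
  have hsplit : a • (t + ρ • c) + b • (t' + σ • c') =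
      (a • t + b • t') + ((a * ρ) • c + (b * σ) • c') := by module
  rw [hsplit]
  exact Set.add_mem_add (smul_add_smul_mem_centers hK ht ht' ha hb hab)
    (Set.add_mem_add (Set.smul_mem_smul_set hc) (Set.smul_mem_smul_set hc'))

theorem convex_roundedBody (hC : Convex ℝ C) (hK : Convex ℝ K) (ρ : ℝ) :
    Convex ℝ (roundedBody C K ρ) := by
  rw [roundedBody_eq_add]
  exact (convex_centers C hK ρ).add (hC.smul ρ)

theorem isCompact_roundedBody (hC : IsCompact C) (hne : C.Nonempty) (hK : IsCompact K) (ρ : ℝ) :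
    IsCompact (roundedBody C K ρ) := by
  rw [roundedBody_eq_add]
  exact (isCompact_centers hne hK ρ).add (hC.smul ρ)

theorem realWidth_roundedBody (hC : IsCompact C) (hne : C.Nonempty) (hK : IsCompact K)
    (hρ : 0 ≤ ρ) (h : (centers C K ρ).Nonempty) (u : E d) :
    realWidth (roundedBody C K ρ) u = realWidth (centers C K ρ) u + ρ * realWidth C u := by
  rw [roundedBody_eq_add, realWidth_add (isCompact_centers hne hK ρ) (hC.smul ρ) h hne.smul_set,
    realWidth_smul hC hne hρ]

theorem isConvexBody_roundedBody (hC : IsConvexBody C) (hK : IsCompact K) (hKc : Convex ℝ K)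
    (hρ : 0 < ρ) (h : (centers C K ρ).Nonempty) : IsConvexBody (roundedBody C K ρ) :=
  ((hC.smul hρ).vadd h.some).of_subset (convex_roundedBody hC.convex hKc ρ)
    (isCompact_roundedBody hC.isCompact hC.nonempty hK ρ) (mem_centers_roundedBody h.some_mem)

theorem le_inradius [Nontrivial (E d)] (hC : IsConvexBody C) (hK : IsCompact K) (hρ : 0 < ρ)
    (h : (centers C K ρ).Nonempty) : ρ ≤ inradius C K := by
  have hsub : {ρ : ℝ | 0 < ρ ∧ ∃ t : E d, t +ᵥ ρ • C ⊆ K} ⊆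
      {ρ : ℝ | 0 ≤ ρ ∧ (centers C K ρ).Nonempty} := fun _ hσ => ⟨hσ.1.le, hσ.2⟩
  exact le_csSup ((bddAbove_centers_nonempty hC.nontrivial hK).mono hsub) ⟨hρ, h⟩

/-- The factors `ρ` for which the `ρC`-rounded body exists and has `C`-width at least `m * ρ`. The
successive inradius `r_C(K, m)` turns out to be the greatest of them. -/
def wideFactors (C K : Set (E d)) (m : ℝ) : Set ℝ :=
  {ρ | 0 ≤ ρ ∧ (centers C K ρ).Nonempty ∧
    ENNReal.ofReal (m * ρ) ≤ minRelWidth C (roundedBody C K ρ)}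

theorem mem_wideFactors_iff (hC : IsConvexBody C) (hK : IsCompact K) {m : ℝ} :
    ρ ∈ wideFactors C K m ↔ 0 ≤ ρ ∧ (centers C K ρ).Nonempty ∧
      ∀ u : E d, ‖u‖ = 1 → (m - 1) * ρ * realWidth C u ≤ realWidth (centers C K ρ) u := by
  refine and_congr_right fun hρ => and_congr_right fun hne => ?_
  rw [ofReal_le_minRelWidth_iff hC (isCompact_roundedBody hC.isCompact hC.nonempty hK ρ)
    (roundedBody_nonempty hC.nonempty hne)]
  refine forall₂_congr fun u _ => ?_
  rw [realWidth_roundedBody hC.isCompact hC.nonempty hK hρ hne, sub_mul, sub_mul, one_mul,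
    sub_le_iff_le_add]

theorem isCompact_wideFactors [Nontrivial (E d)] (hC : IsConvexBody C) (hK : IsCompact K)
    (m : ℝ) : IsCompact (wideFactors C K m) := by
  let G : Set (ℝ × E d) := {p | 0 ≤ p.1 ∧ p.2 ∈ centers C K p.1}
  let S : E d → Set ℝ := fun u => {ρ | (∃ t, (ρ, t) ∈ G) ∧
    (m - 1) * ρ * realWidth C u ≤ realWidth {t | (ρ, t) ∈ G} u}
  have hS : ∀ u, IsCompact (S u) := fun u => isCompact_setOf_le_realWidth_section
    (isCompact_centers_graph hC.nontrivial hK) (by fun_prop) u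
  have hsection : ∀ ρ, 0 ≤ ρ → {t | (ρ, t) ∈ G} = centers C K ρ := fun ρ hρ =>
    Set.ext fun t => and_iff_right hρ
  obtain ⟨u, hu⟩ := exists_norm_eq (E d) zero_le_one
  have hinter : wideFactors C K m = ⋂ v ∈ {v : E d | ‖v‖ = 1}, S v := by
    ext ρ
    rw [mem_wideFactors_iff hC hK, Set.mem_iInter₂]
    constructor
    · rintro ⟨hρ, ⟨t, ht⟩, h⟩ v hv
      exact ⟨⟨t, hρ, ht⟩, (hsection ρ hρ).symm ▸ h v hv⟩
    · intro h
      obtain ⟨⟨t, hρ, ht⟩, -⟩ := h u hu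
      exact ⟨hρ, ⟨t, ht⟩, fun v hv => hsection ρ hρ ▸ (h v hv).2⟩
  rw [hinter]
  exact (hS u).of_isClosed_subset (isClosed_biInter fun v _ => (hS v).isClosed)
    (Set.biInter_subset_of_mem hu)

theorem div_mem_wideFactors (hC : IsConvexBody C) (hK : IsCompact K) {m : ℝ} (hm : 1 ≤ m)
    (hρ : 0 ≤ ρ) (h : (centers C K ρ).Nonempty) : ρ / m ∈ wideFactors C K m := by
  have hm0 : 0 < m := one_pos.trans_le hm
  have hle : ρ / m ≤ ρ := div_le_self hρ hm
  have hρm : 0 ≤ ρ / m := by positivity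
  refine ⟨hρm, centers_nonempty_anti hC.convex hC.nonempty hρm hle h, ?_⟩
  rw [mul_div_cancel₀ _ hm0.ne']
  exact ofReal_le_minRelWidth_of_mem_centers hC
    (isCompact_roundedBody hC.isCompact hC.nonempty hK _)
    ((mem_centers_roundedBody h.some_mem).trans (roundedBody_anti hC.convex K hρm hle))

theorem isConvexBody_centers (hC : IsConvexBody C) (hK : IsCompact K) (hKc : Convex ℝ K) {c : ℝ}
    (hs : 0 ≤ s) (hne : (centers C K s).Nonempty) (hc : s < c)
    (h : ENNReal.ofReal c ≤ minRelWidth C (roundedBody C K s)) :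
    IsConvexBody (centers C K s) := by
  rw [ofReal_le_minRelWidth_iff hC (isCompact_roundedBody hC.isCompact hC.nonempty hK s)
    (roundedBody_nonempty hC.nonempty hne)] at h
  have hZ := isCompact_centers hC.nonempty hK s
  refine ⟨convex_centers C hKc s, hZ,
    interior_nonempty_of_realWidth_pos (convex_centers C hKc s) hZ hne fun u hu => ?_⟩
  have hw := h u hu
  rw [realWidth_roundedBody hC.isCompact hC.nonempty hK hs hne] at hw
  linarith [mul_lt_mul_of_pos_right hc (hC.realWidth_pos hu)]

/-- If the rounded body is wider than required, then its set of centers contains a translate of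
`δ • C` for some `δ > 0`, so `K` contains a translate of `(s + δ) • C`; interpolating between the
factors `s` and `s + δ` costs little width. -/
theorem exists_mem_wideFactors_gt (hC : IsConvexBody C) (hK : IsCompact K) (hKc : Convex ℝ K)
    {m c : ℝ} (hm : 1 ≤ m) (hs : 0 ≤ s) (hne : (centers C K s).Nonempty) (hc : m * s < c)
    (h : ENNReal.ofReal c ≤ minRelWidth C (roundedBody C K s)) :
    ∃ ρ ∈ wideFactors C K m, s < ρ := by
  have hRc : ∀ σ, IsCompact (roundedBody C K σ) :=
    isCompact_roundedBody hC.isCompact hC.nonempty hK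
  have hRne := roundedBody_nonempty hC.nonempty hne
  have hZ := isConvexBody_centers hC hK hKc hs hne ((le_mul_of_one_le_left hs hm).trans_lt hc) h
  obtain ⟨δ, hδ, t, ht⟩ := hZ.exists_mem_centers hC.isCompact
  rw [ofReal_le_minRelWidth_iff hC (hRc s) hRne] at h
  obtain ⟨y, hy⟩ := roundedBody_nonempty hC.nonempty ⟨t, centers_centers_subset ht⟩
  have hlim : ∀ᶠ l in nhds (0 : ℝ), m * (s + l * δ) < (1 - l) * c ∧ l < 1 :=
    (ContinuousAt.eventually_lt (by fun_prop) (by fun_prop) (by simpa using hc)).and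
      (eventually_lt_nhds one_pos)
  obtain ⟨l, ⟨hlc, hl1⟩, hl0⟩ :=
    ((hlim.filter_mono nhdsWithin_le_nhds).and (self_mem_nhdsWithin (s := Set.Ioi 0))).exists
  have hlδ : 0 < l * δ := mul_pos hl0 hδ
  have hsub : (l • y) +ᵥ (1 - l) • roundedBody C K s ⊆ roundedBody C K (s + l * δ) := by
    rintro _ ⟨_, ⟨x, hx, rfl⟩, rfl⟩
    convert smul_add_smul_mem_roundedBody hC.convex hKc hs (by positivity) hx hy
      (sub_nonneg.2 hl1.le) hl0.le (by ring) using 1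
    · congr 1
      ring
    · exact add_comm _ _
  refine ⟨s + l * δ, ⟨by positivity, ?_, ?_⟩, by linarith⟩
  · refine centers_nonempty_anti hC.convex hC.nonempty (by positivity) ?_
      ⟨t, centers_centers_subset ht⟩
    nlinarith
  · refine (ofReal_le_minRelWidth_iff hC (hRc _)
      ((hRne.smul_set.vadd_set).mono hsub)).2 fun u hu => ?_
    calc m * (s + l * δ) * realWidth C u ≤ (1 - l) * c * realWidth C u := by
          gcongr
          exact (hC.realWidth_pos hu).le
      _ ≤ (1 - l) * realWidth (roundedBody C K s) u := by
          rw [mul_assoc]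
          exact mul_le_mul_of_nonneg_left (h u hu) (sub_nonneg.2 hl1.le)
      _ ≤ realWidth (roundedBody C K (s + l * δ)) u :=
          mul_realWidth_le_of_vadd_smul_subset (hRc s) hRne (hRc _) hsub u

theorem minRelWidth_roundedBody_of_isGreatest (hC : IsConvexBody C) (hK : IsCompact K)
    (hKc : Convex ℝ K) {m : ℝ} (hm : 1 ≤ m) (h : IsGreatest (wideFactors C K m) s) :
    minRelWidth C (roundedBody C K s) = ENNReal.ofReal (m * s) := by
  obtain ⟨⟨hs, hne, hle⟩, hmax⟩ := h
  refine hle.antisymm' (le_of_not_gt fun hlt => ?_)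
  obtain ⟨c, -, hc, hc'⟩ := ENNReal.lt_iff_exists_real_btwn.1 hlt
  obtain ⟨ρ, hρ, hsρ⟩ := exists_mem_wideFactors_gt hC hK hKc hm hs hne
    (ENNReal.ofReal_lt_ofReal_iff'.1 hc).1 hc'.le
  exact hsρ.not_ge (hmax hρ)

theorem succInradius_eq_of (hC : Convex ℝ C) {m : ℕ} (hm : 1 ≤ m) (hρ : 0 < ρ)
    (hle : ρ ≤ inradius C K)
    (h : minRelWidth C (roundedBody C K ρ) = ENNReal.ofReal (m * ρ)) :
    succInradius C K m = ρ := by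
  have hm0 : (0 : ℝ) < m := by exact_mod_cast hm
  have hanti : ∀ {a b : ℝ}, 0 < a →
      minRelWidth C (roundedBody C K a) = ENNReal.ofReal (m * a) →
      minRelWidth C (roundedBody C K b) = ENNReal.ofReal (m * b) → a ≤ b → b ≤ a := by
    intro a b ha ea eb hab
    have hmono := minRelWidth_mono C (roundedBody_anti hC K ha.le hab)
    rw [ea, eb, ENNReal.ofReal_le_ofReal_iff (by positivity)] at hmono
    exact le_of_mul_le_mul_left hmono hm0
  have hsingleton : {ρ : ℝ | 0 < ρ ∧ ρ ≤ inradius C K ∧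
      minRelWidth C (roundedBody C K ρ) = ENNReal.ofReal ((m : ℝ) * ρ)} = {ρ} := by
    refine Set.eq_singleton_iff_unique_mem.2 ⟨⟨hρ, hle, h⟩, ?_⟩
    rintro σ ⟨hσ, -, hσe⟩
    rcases le_total ρ σ with hρσ | hσρ
    · exact (hanti hρ h hσe hρσ).antisymm hρσ
    · exact hσρ.antisymm (hanti hσ hσe h hσρ)
  rw [succInradius, hsingleton, csSup_singleton]

section SuccInradius

variable [Nontrivial (E d)] {m : ℕ}

theorem isGreatest_succInradius (hC : IsConvexBody C) (hK : IsConvexBody K) (hm : 1 ≤ m) :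
    IsGreatest (wideFactors C K m) (succInradius C K m) := by
  have hm' : (1 : ℝ) ≤ m := by exact_mod_cast hm
  obtain ⟨r, hr, t, ht⟩ := hK.exists_mem_centers hC.isCompact
  have hmem := div_mem_wideFactors hC hK.isCompact hm' hr.le ⟨t, ht⟩
  obtain ⟨s, hs⟩ := (isCompact_wideFactors hC hK.isCompact m).exists_isGreatest ⟨_, hmem⟩
  have hs0 : 0 < s := (div_pos hr (one_pos.trans_le hm')).trans_le (hs.2 hmem)
  rwa [succInradius_eq_of hC.convex hm hs0 (le_inradius hC hK.isCompact hs0 hs.1.2.1)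
    (minRelWidth_roundedBody_of_isGreatest hC hK.isCompact hK.convex hm' hs)]

theorem le_succInradius (hC : IsConvexBody C) (hK : IsConvexBody K) (hm : 1 ≤ m)
    (h : ρ ∈ wideFactors C K m) : ρ ≤ succInradius C K m :=
  (isGreatest_succInradius hC hK hm).2 h

theorem centers_succInradius_nonempty (hC : IsConvexBody C) (hK : IsConvexBody K) (hm : 1 ≤ m) :
    (centers C K (succInradius C K m)).Nonempty :=
  (isGreatest_succInradius hC hK hm).1.2.1

theorem minRelWidth_roundedBody_succInradius (hC : IsConvexBody C) (hK : IsConvexBody K)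
    (hm : 1 ≤ m) :
    minRelWidth C (roundedBody C K (succInradius C K m)) =
      ENNReal.ofReal (m * succInradius C K m) :=
  minRelWidth_roundedBody_of_isGreatest hC hK.isCompact hK.convex (by exact_mod_cast hm)
    (isGreatest_succInradius hC hK hm)

theorem div_le_succInradius (hC : IsConvexBody C) (hK : IsConvexBody K) (hm : 1 ≤ m)
    (hρ : 0 ≤ ρ) (h : (centers C K ρ).Nonempty) : ρ / m ≤ succInradius C K m :=
  le_succInradius hC hK hm (div_mem_wideFactors hC hK.isCompact (by exact_mod_cast hm) hρ h)

theorem succInradius_pos (hC : IsConvexBody C) (hK : IsConvexBody K) (hm : 1 ≤ m) :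
    0 < succInradius C K m := by
  obtain ⟨r, hr, t, ht⟩ := hK.exists_mem_centers hC.isCompact
  exact (div_pos hr (by exact_mod_cast hm)).trans_le (div_le_succInradius hC hK hm hr.le ⟨t, ht⟩)

theorem one_div_le_succInradius_self (hC : IsConvexBody C) (hm : 1 ≤ m) :
    1 / (m : ℝ) ≤ succInradius C C m :=
  div_le_succInradius hC hC hm zero_le_one ⟨0, by simp [mem_centers]⟩

theorem succInradius_one (hC : IsConvexBody C) (hK : IsConvexBody K) :
    succInradius C K 1 = inradius C K := by
  rw [inradius, eq_comm]
  refine IsGreatest.csSup_eq ⟨⟨succInradius_pos hC hK le_rfl,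
    centers_succInradius_nonempty hC hK le_rfl⟩, ?_⟩
  rintro ρ ⟨hρ, h⟩
  simpa using div_le_succInradius hC hK le_rfl hρ.le h

end SuccInradius

namespace Plank

theorem relWidth_eq_ofReal (hC : IsConvexBody C) (P : Plank d) :
    P.relWidth C = ENNReal.ofReal ((P.hi - P.lo) / realWidth C P.normal) := by
  rw [relWidth, width_eq_ofReal hC.isCompact hC.nonempty,
    ENNReal.ofReal_div_of_pos (hC.realWidth_pos P.norm_normal)]

theorem relWidth_ne_top (hC : IsConvexBody C) (P : Plank d) : P.relWidth C ≠ ∞ := by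
  rw [relWidth_eq_ofReal hC]
  exact ENNReal.ofReal_ne_top

theorem toReal_relWidth (hC : IsConvexBody C) (P : Plank d) :
    (P.relWidth C).toReal = (P.hi - P.lo) / realWidth C P.normal := by
  rw [relWidth_eq_ofReal hC, ENNReal.toReal_ofReal
    (div_nonneg (sub_nonneg.2 P.lo_lt_hi.le) (hC.realWidth_pos P.norm_normal).le)]

theorem inner_normal_smul (P : Plank d) (a : ℝ) : inner ℝ P.normal (a • P.normal) = a := by
  rw [real_inner_smul_right, real_inner_self_eq_norm_sq, P.norm_normal, one_pow, mul_one]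

theorem smul_normal_mem_carrier (P : Plank d) {a : ℝ} (h : P.lo ≤ a) (h' : a ≤ P.hi) :
    a • P.normal ∈ P.carrier := by
  rw [carrier, Set.mem_ofPred_eq, P.inner_normal_smul]
  exact ⟨h, h'⟩

theorem width_carrier_normal (P : Plank d) :
    width P.carrier P.normal = ENNReal.ofReal (P.hi - P.lo) := by
  apply le_antisymm
  · refine iSup₂_le fun x hx => iSup₂_le fun y hy => ENNReal.ofReal_le_ofReal ?_
    exact sub_le_sub hx.2 hy.1
  · have h := P.lo_lt_hi.le
    refine le_iSup₂_of_le _ (P.smul_normal_mem_carrier h le_rfl)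
      (le_iSup₂_of_le _ (P.smul_normal_mem_carrier le_rfl h) ?_)
    rw [P.inner_normal_smul, P.inner_normal_smul]

theorem width_carrier_eq_top (P : Plank d) (hu : u ∉ Submodule.span ℝ {P.normal}) :
    width P.carrier u = ∞ := by
  obtain ⟨z, hz, hz0⟩ := exists_inner_eq_zero_and_inner_ne_zero hu
  have hmem : ∀ a : ℝ, P.lo • P.normal + a • z ∈ P.carrier := by
    intro a
    rw [carrier, Set.mem_ofPred_eq, inner_add_right, P.inner_normal_smul, real_inner_smul_right,
      hz, mul_zero, add_zero]
    exact ⟨le_rfl, P.lo_lt_hi.le⟩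
  refine ENNReal.eq_top_of_forall_nnreal_le fun r => ?_
  refine le_iSup₂_of_le _ (hmem (r / inner ℝ u z)) (le_iSup₂_of_le _ (hmem 0) ?_)
  rw [inner_add_right, inner_add_right, add_sub_add_left_eq_sub, real_inner_smul_right,
    real_inner_smul_right, div_mul_cancel₀ _ hz0, zero_mul, sub_zero, ENNReal.ofReal_coe_nnreal]

theorem eq_normal_or_eq_neg_normal (P : Plank d) (hu : ‖u‖ = 1)
    (h : u ∈ Submodule.span ℝ {P.normal}) : u = P.normal ∨ u = -P.normal := by
  obtain ⟨a, rfl⟩ := Submodule.mem_span_singleton.1 h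
  rw [norm_smul, P.norm_normal, mul_one, Real.norm_eq_abs] at hu
  rcases eq_or_eq_neg_of_abs_eq hu with rfl | rfl
  · exact Or.inl (one_smul _ _)
  · exact Or.inr (neg_one_smul _ _)

theorem minRelWidth_carrier (hC : IsConvexBody C) (P : Plank d) :
    minRelWidth C P.carrier = P.relWidth C := by
  have hnormal : PlankInradii.relWidth C P.carrier P.normal = P.relWidth C := by
    rw [PlankInradii.relWidth, width_carrier_normal, relWidth]
  refine le_antisymm (hnormal ▸ minRelWidth_le C P.carrier P.norm_normal)
    (le_minRelWidth_iff.2 fun u hu => ?_)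
  by_cases hspan : u ∈ Submodule.span ℝ {P.normal}
  · rcases P.eq_normal_or_eq_neg_normal hu hspan with rfl | rfl
    · exact hnormal.ge
    · rw [PlankInradii.relWidth, width_neg, width_neg]
      exact hnormal.ge
  · rw [PlankInradii.relWidth, P.width_carrier_eq_top hspan,
      ENNReal.top_div_of_ne_top (hC.width_ne_top u)]
    exact le_top

theorem roundedBody_carrier (hC : IsConvexBody C) (P : Plank d) (hρ : 0 ≤ ρ)
    (h : ρ * realWidth C P.normal ≤ P.hi - P.lo) : roundedBody C P.carrier ρ = P.carrier := by
  refine (roundedBody_subset _ _ _).antisymm fun x hx => ?_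
  obtain ⟨a, ha, b, hb, hab, e⟩ := exists_realWidth_eq hC.isCompact hC.nonempty P.normal
  have hD : 0 < P.hi - P.lo := sub_pos.2 P.lo_lt_hi
  obtain ⟨θ, hθ⟩ : ∃ θ, θ = (inner ℝ P.normal x - P.lo) / (P.hi - P.lo) := ⟨_, rfl⟩
  have hθ0 : 0 ≤ θ := hθ ▸ div_nonneg (sub_nonneg.2 hx.1) hD.le
  have hθ1 : 0 ≤ 1 - θ := sub_nonneg.2 (hθ ▸ (div_le_one hD).2 (sub_le_sub_right hx.2 _))
  have hθD : θ * (P.hi - P.lo) = inner ℝ P.normal x - P.lo := hθ ▸ div_mul_cancel₀ _ hD.ne'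
  refine mem_roundedBody.2 ⟨x - ρ • ((1 - θ) • a + θ • b), mem_centers.2 fun c hc => ?_,
    (1 - θ) • a + θ • b, hC.convex ha hb hθ1 hθ0 (sub_add_cancel _ _), sub_add_cancel _ _⟩
  rw [e] at h
  rw [carrier, Set.mem_ofPred_eq, inner_add_right, inner_sub_right]
  simp only [real_inner_smul_right, inner_add_right]
  constructor
  · linarith [mul_le_mul_of_nonneg_left h hθ0, mul_le_mul_of_nonneg_left (hab c hc).1 hρ]
  · linarith [mul_le_mul_of_nonneg_left h hθ1, mul_le_mul_of_nonneg_left (hab c hc).2 hρ]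

theorem mul_realWidth_le_of_mem_centers (hC : IsConvexBody C) (P : Plank d) {t : E d}
    (ht : t ∈ centers C P.carrier ρ) : ρ * realWidth C P.normal ≤ P.hi - P.lo := by
  obtain ⟨a, ha, b, hb, -, e⟩ := exists_realWidth_eq hC.isCompact hC.nonempty P.normal
  have hlo := (mem_centers.1 ht a ha).1
  have hhi := (mem_centers.1 ht b hb).2
  rw [inner_add_right, real_inner_smul_right] at hlo hhi
  rw [e]
  linarith

theorem inradius_carrier (hC : IsConvexBody C) (P : Plank d) :
    inradius C P.carrier = (P.relWidth C).toReal := by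
  have hw := hC.realWidth_pos P.norm_normal
  have hD : 0 < P.hi - P.lo := sub_pos.2 P.lo_lt_hi
  rw [toReal_relWidth hC]
  refine IsGreatest.csSup_eq ⟨⟨by positivity, ?_⟩, ?_⟩
  · have hmem := P.smul_normal_mem_carrier le_rfl P.lo_lt_hi.le
    rw [← P.roundedBody_carrier hC (div_nonneg hD.le hw.le) (div_mul_cancel₀ _ hw.ne').le] at hmem
    obtain ⟨t, ht, -⟩ := mem_roundedBody.1 hmem
    exact ⟨t, ht⟩
  · rintro ρ ⟨-, t, ht⟩
    exact (le_div_iff₀ hw).2 (P.mul_realWidth_le_of_mem_centers hC ht)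

theorem succInradius_carrier (hC : IsConvexBody C) (P : Plank d) {m : ℕ} (hm : 1 ≤ m) :
    succInradius C P.carrier m = (P.relWidth C).toReal / m := by
  have hm' : (1 : ℝ) ≤ m := by exact_mod_cast hm
  have hw := hC.realWidth_pos P.norm_normal
  have hpos : 0 < (P.relWidth C).toReal := by
    rw [toReal_relWidth hC]
    exact div_pos (sub_pos.2 P.lo_lt_hi) hw
  have hle : (P.relWidth C).toReal / m ≤ (P.relWidth C).toReal := div_le_self hpos.le hm'
  refine succInradius_eq_of hC.convex hm (by positivity) (hle.trans_eq (P.inradius_carrier hC).symm)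
    ?_
  rw [P.roundedBody_carrier hC (by positivity), minRelWidth_carrier hC,
    mul_div_cancel₀ _ (by positivity), ENNReal.ofReal_toReal (P.relWidth_ne_top hC)]
  rwa [← le_div_iff₀ hw, ← toReal_relWidth hC]

end Plank

theorem succPlankConjecture_iff {m : ℕ} (hm : 1 ≤ m) :
    SuccPlankConjecture d m ↔ SuccPlankWidthConjecture d m := by
  have hm0 : (0 : ℝ) < m := by exact_mod_cast hm
  refine forall₄_congr fun K C _ hC => forall₃_congr fun n P _ => ?_
  have hne : ∀ i ∈ Finset.univ, (P i).relWidth C ≠ ∞ := fun i _ => (P i).relWidth_ne_top hC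
  simp only [Plank.succInradius_carrier hC _ hm]
  rw [ENNReal.ofReal_le_iff_le_toReal (ENNReal.sum_ne_top.2 hne), ENNReal.toReal_sum hne,
    ← Finset.sum_div, le_div_iff₀' hm0]

theorem minRelWidth_mul_relWidth_le (hK : IsConvexBody K) (C : Set (E d)) (P : Plank d) :
    minRelWidth C K * P.relWidth K ≤ P.relWidth C := by
  refine (mul_le_mul_left (minRelWidth_le C K P.norm_normal) _).trans_eq ?_
  rw [relWidth, Plank.relWidth, Plank.relWidth, mul_comm, ← mul_div_assoc,
    ENNReal.div_mul_cancel (hK.width_ne_zero P.norm_normal) (hK.width_ne_top P.normal)]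

theorem BangConjecture.bodyPlank (h : BangConjecture d) : BodyPlankConjecture d := by
  intro K hK n P hP C _
  calc minRelWidth C K ≤ minRelWidth C K * ∑ i, (P i).relWidth K :=
        le_mul_of_one_le_right' (h K hK n P hP)
    _ = ∑ i, minRelWidth C K * (P i).relWidth K := Finset.mul_sum _ _ _
    _ ≤ ∑ i, (P i).relWidth C :=
        Finset.sum_le_sum fun i _ => minRelWidth_mul_relWidth_le hK C (P i)

section PlankConjectures

variable [Nontrivial (E d)] {m : ℕ}

theorem BodyPlankConjecture.succPlankWidth (h : BodyPlankConjecture d) (hm : 1 ≤ m) :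
    SuccPlankWidthConjecture d m := by
  intro K C hK hC n P hP
  rw [← minRelWidth_roundedBody_succInradius hC hK hm]
  exact h _ (isConvexBody_roundedBody hC hK.isCompact hK.convex (succInradius_pos hC hK hm)
    (centers_succInradius_nonempty hC hK hm)) n P ((roundedBody_subset _ _ _).trans hP) C hC

theorem SuccPlankWidthConjecture.bang (h : SuccPlankWidthConjecture d m) (hm : 1 ≤ m) :
    BangConjecture d := by
  intro C hC n P hP
  refine le_trans ?_ (h C C hC hC n P hP)
  have hm0 : (0 : ℝ) < m := by exact_mod_cast hm
  rw [ENNReal.one_le_ofReal, ← div_le_iff₀' hm0]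
  exact one_div_le_succInradius_self hC hm

end PlankConjectures

theorem Hyperplane.dense_setOf_inner_ne (H : Hyperplane d) :
    Dense {x : E d | inner ℝ H.normal x ≠ H.offset} := by
  have hne : innerₛₗ ℝ H.normal ≠ 0 := fun h => by
    have := congrArg (fun f => f H.normal) h
    simp [H.norm_normal] at this
  exact (dense_compl_singleton H.offset).preimage
    ((innerₛₗ ℝ H.normal).isOpenMap_of_finiteDimensional (LinearMap.surjective hne))

section Pieces

variable {k : ℕ} {H : Fin k → Hyperplane d}

theorem isPiece_fin_zero_iff (hK : K.Nonempty) (H : Fin 0 → Hyperplane d) :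
    IsPiece K H Q ↔ Q = K := by
  simpa [IsPiece] using fun _ => Set.nonempty_def.1 hK

namespace IsPiece

theorem subset (hQ : IsPiece K H Q) : Q ⊆ K := by
  obtain ⟨x, -, -, rfl⟩ := hQ
  exact fun y hy => hy.1

theorem isConvexBody (hK : IsConvexBody K) (hQ : IsPiece K H Q) : IsConvexBody Q := by
  obtain ⟨x, hx, hxH, rfl⟩ := hQ
  let f : Fin k → E d → ℝ := fun i y => (inner ℝ (H i).normal x - (H i).offset) *
    (inner ℝ (H i).normal y - (H i).offset)
  have hf : ∀ i, Continuous (f i) := fun i => by fun_prop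
  have hconv : Convex ℝ {y | ∀ i, 0 ≤ f i y} := by
    rw [Set.ofPred_forall]
    refine convex_iInter fun i => ?_
    simpa only [f, mul_sub, sub_nonneg, LinearMap.smul_apply, smul_eq_mul,
      innerₛₗ_apply_apply] using convex_halfSpace_ge
      ((inner ℝ (H i).normal x - (H i).offset) • innerₛₗ ℝ (H i).normal).isLinear
      ((inner ℝ (H i).normal x - (H i).offset) * (H i).offset)
  have hclosed : IsClosed {y | ∀ i, 0 ≤ f i y} := by
    rw [Set.ofPred_forall]
    exact isClosed_iInter fun i => isClosed_le continuous_const (hf i)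
  refine ⟨hK.convex.inter hconv, hK.isCompact.inter_right hclosed, ?_⟩
  · have hopen : IsOpen {y | ∀ i, 0 < f i y} := by
      rw [Set.ofPred_forall]
      exact isOpen_iInter_of_finite fun i => isOpen_lt continuous_const (hf i)
    have hxcl : x ∈ closure (interior K) := by
      rw [hK.convex.closure_interior_eq_closure_of_nonempty_interior hK.interior_nonempty]
      exact subset_closure hx
    obtain ⟨y, hy⟩ := mem_closure_iff.1 hxcl _ hopen fun i =>
      mul_self_pos.2 (sub_ne_zero.2 (hxH i))
    refine ⟨y, mem_interior.2 ⟨_, fun z hz => ?_, hopen.inter isOpen_interior, hy⟩⟩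
    exact ⟨interior_subset hz.2, fun i => (hz.1 i).le⟩

theorem inner_le_offset (hQ : IsPiece K H Q) {p q : E d} (hp : p ∈ Q) (hq : q ∈ Q) {i : Fin k}
    (hlt : inner ℝ (H i).normal q < (H i).offset) : inner ℝ (H i).normal p ≤ (H i).offset := by
  obtain ⟨x, -, hxH, rfl⟩ := hQ
  have hx : inner ℝ (H i).normal x - (H i).offset < 0 :=
    (nonpos_of_mul_nonneg_left (hq.2 i) (sub_neg.2 hlt)).lt_of_ne (sub_ne_zero.2 (hxH i))
  exact sub_nonpos.1 (nonpos_of_mul_nonneg_right (hp.2 i) hx)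

end IsPiece

theorem finite_setOf_isPiece (K : Set (E d)) (H : Fin k → Hyperplane d) :
    {Q | IsPiece K H Q}.Finite := by
  refine (Set.finite_range fun σ : Fin k → SignType => {y ∈ K | ∀ i, 0 ≤
    (σ i : ℝ) * (inner ℝ (H i).normal y - (H i).offset)}).subset ?_
  rintro Q ⟨x, -, hxH, rfl⟩
  refine ⟨fun i => SignType.sign (inner ℝ (H i).normal x - (H i).offset), ?_⟩
  ext y
  refine and_congr_right fun _ => forall_congr' fun i => ?_
  beta_reduce
  rcases (sub_ne_zero.2 (hxH i)).lt_or_gt with h | h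
  · rw [sign_neg h, ← neg_mul_neg (inner ℝ (H i).normal x - (H i).offset),
      mul_nonneg_iff_of_pos_left (neg_pos.2 h), SignType.coe_neg_one, neg_one_mul]
  · rw [sign_pos h, mul_nonneg_iff_of_pos_left h, SignType.coe_one, one_mul]

theorem exists_isPiece (hK : IsConvexBody K) (H : Fin k → Hyperplane d) :
    ∃ Q, IsPiece K H Q := by
  have hdense := dense_iInter_of_isOpen (fun i => isOpen_ne_fun (by fun_prop) continuous_const)
    fun i => (H i).dense_setOf_inner_ne
  obtain ⟨x, hx, hxH⟩ := hdense.inter_open_nonempty _ isOpen_interior hK.interior_nonempty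
  exact ⟨_, x, interior_subset hx, Set.mem_iInter.1 hxH, rfl⟩

theorem exists_isGreatest_isPiece (hK : IsConvexBody K) (H : Fin k → Hyperplane d)
    (f : Set (E d) → ℝ) : ∃ ρ, IsGreatest {r : ℝ | ∃ Q, IsPiece K H Q ∧ r = f Q} ρ := by
  obtain ⟨Q, hQ, hmax⟩ :=
    Set.exists_max_image {Q | IsPiece K H Q} f (finite_setOf_isPiece K H) (exists_isPiece hK H)
  refine ⟨f Q, ⟨Q, hQ, rfl⟩, ?_⟩
  rintro _ ⟨Q', hQ', rfl⟩
  exact hmax Q' hQ'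

theorem exists_isPiece_superset (hL : L.Nonempty) (hLK : L ⊆ K)
    (h : ∀ i, (∀ y ∈ L, inner ℝ (H i).normal y < (H i).offset) ∨
      ∀ y ∈ L, (H i).offset < inner ℝ (H i).normal y) :
    ∃ Q, IsPiece K H Q ∧ L ⊆ Q := by
  obtain ⟨x, hx⟩ := hL
  refine ⟨_, ⟨x, hLK hx, fun i => ?_, rfl⟩, fun y hy => ⟨hLK hy, fun i => ?_⟩⟩
  · exact (h i).elim (fun h => (h x hx).ne) fun h => (h x hx).ne'
  · rcases h i with h | h
    · exact mul_nonneg_of_nonpos_of_nonpos (sub_nonpos.2 (h x hx).le) (sub_nonpos.2 (h y hy).le)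
    · exact mul_nonneg (sub_nonneg.2 (h x hx).le) (sub_nonneg.2 (h y hy).le)

theorem exists_multiple_between {x y η : ℝ} {k : ℕ} (hη : 0 < η) (hx : 0 ≤ x) (hxy : x + η < y)
    (hk : x < k * η) : ∃ j : Fin k, x < (j + 1) * η ∧ (j + 1) * η < y := by
  have hle := (le_div_iff₀ hη).1 (Nat.floor_le (div_nonneg hx hη.le))
  have hlt := (div_lt_iff₀ hη).1 (Nat.lt_floor_add_one (x / η))
  refine ⟨⟨⌊x / η⌋₊, (Nat.floor_lt (div_nonneg hx hη.le)).2 ((div_lt_iff₀ hη).2 hk)⟩, hlt, ?_⟩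
  simp only
  linarith

theorem exists_slicing_inner_sub_le {R : Set (E d)} (hR : IsCompact R) (hne : R.Nonempty)
    (hu : ‖u‖ = 1) {δ : ℝ} (hδ : 0 < δ) (hw : realWidth R u ≤ (k + 1) * δ) :
    ∃ H : Fin k → Hyperplane d, ∀ K Q, IsPiece K H Q →
      ∀ p ∈ Q ∩ R, ∀ q ∈ Q ∩ R, inner ℝ u p - inner ℝ u q ≤ δ := by
  obtain ⟨a, -, b, -, hab, e⟩ := exists_realWidth_eq hR hne u
  refine ⟨fun j => ⟨u, hu, inner ℝ u a + (j + 1) * δ⟩, fun K Q hQ p hp q hq => ?_⟩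
  by_contra! hlt
  obtain ⟨j, hqj, hjp⟩ := exists_multiple_between (k := k) hδ
    (x := inner ℝ u q - inner ℝ u a) (y := inner ℝ u p - inner ℝ u a)
    (sub_nonneg.2 (hab q hq.2).1) (by linarith) (by linarith [(hab p hp.2).2])
  exact (hQ.inner_le_offset hp.1 hq.1 (i := j) (sub_lt_iff_lt_add'.1 hqj)).not_gt
    (lt_sub_iff_add_lt'.1 hjp)

/-- The translates of `L` by `t ∈ T` that meet the hyperplane `H i` are those with `t` in a plank
as wide as `L`; by Bang's conjecture these planks do not cover `T`. -/
theorem BangConjecture.exists_vadd_off_hyperplanes (hB : BangConjecture d) {T : Set (E d)}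
    (hT : IsConvexBody T) (hL : IsCompact L) (hint : (interior L).Nonempty)
    (H : Fin k → Hyperplane d)
    (hsum : ∑ i, realWidth L (H i).normal / realWidth T (H i).normal < 1) :
    ∃ t ∈ T, ∀ i, (∀ y ∈ t +ᵥ L, inner ℝ (H i).normal y < (H i).offset) ∨
      ∀ y ∈ t +ᵥ L, (H i).offset < inner ℝ (H i).normal y := by
  choose a _ b _ hab e using fun i =>
    exists_realWidth_eq hL (hint.mono interior_subset) (H i).normal
  have hpos : ∀ i, 0 < realWidth L (H i).normal := fun i =>
    realWidth_pos hL hint (H i).norm_normal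
  let P : Fin k → Plank d := fun i =>
    { normal := (H i).normal
      norm_normal := (H i).norm_normal
      lo := (H i).offset - inner ℝ (H i).normal (b i)
      hi := (H i).offset - inner ℝ (H i).normal (a i)
      lo_lt_hi := by linarith [hpos i, e i] }
  have hP : ∀ i, (P i).relWidth T =
      ENNReal.ofReal (realWidth L (H i).normal / realWidth T (H i).normal) := fun i => by
    rw [Plank.relWidth_eq_ofReal hT, e i, sub_sub_sub_cancel_left]
  have hnn : ∀ i ∈ Finset.univ, 0 ≤ realWidth L (H i).normal / realWidth T (H i).normal :=
    fun i _ => (div_pos (hpos i) (hT.realWidth_pos (H i).norm_normal)).le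
  have hcover : ¬ T ⊆ ⋃ i, (P i).carrier := fun hTP => by
    have := hB T hT k P hTP
    simp only [hP] at this
    rw [← ENNReal.ofReal_sum_of_nonneg hnn, ENNReal.one_le_ofReal] at this
    exact hsum.not_ge this
  obtain ⟨t, ht, htP⟩ := Set.not_subset.1 hcover
  refine ⟨t, ht, fun i => ?_⟩
  have hti : t ∉ (P i).carrier := fun h => htP (Set.mem_iUnion.2 ⟨i, h⟩)
  rw [Plank.carrier, Set.mem_ofPred_eq, not_and_or, not_le, not_le] at hti
  refine hti.imp ?_ ?_
  · rintro h _ ⟨y, hy, rfl⟩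
    simp only [P, vadd_eq_add, inner_add_right] at h ⊢
    linarith [(hab i y hy).2]
  · rintro h _ ⟨y, hy, rfl⟩
    simp only [P, vadd_eq_add, inner_add_right] at h ⊢
    linarith [(hab i y hy).1]

theorem BangConjecture.exists_isPiece_vadd_subset (hB : BangConjecture d) {T : Set (E d)}
    (hT : IsConvexBody T) (hL : IsCompact L) (hint : (interior L).Nonempty) (hTL : T + L ⊆ K)
    (H : Fin k → Hyperplane d) (hw : ∀ u, ‖u‖ = 1 → k * realWidth L u < realWidth T u) :
    ∃ Q, IsPiece K H Q ∧ ∃ t : E d, t +ᵥ L ⊆ Q := by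
  have hsum : ∑ i, realWidth L (H i).normal / realWidth T (H i).normal < 1 := by
    rcases k.eq_zero_or_pos with rfl | hk
    · simp
    have hk' : (0 : ℝ) < k := by exact_mod_cast hk
    have : Nonempty (Fin k) := ⟨⟨0, hk⟩⟩
    calc ∑ i, realWidth L (H i).normal / realWidth T (H i).normal < ∑ _i : Fin k, 1 / (k : ℝ) :=
          Finset.sum_lt_sum_of_nonempty Finset.univ_nonempty fun i _ => by
            rw [div_lt_div_iff₀ (hT.realWidth_pos (H i).norm_normal) hk', one_mul, mul_comm]
            exact hw _ (H i).norm_normal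
      _ = 1 := by
        rw [Finset.sum_const, Finset.card_univ, Fintype.card_fin, nsmul_eq_mul,
          mul_one_div_cancel hk'.ne']
  obtain ⟨t, ht, hside⟩ := hB.exists_vadd_off_hyperplanes hT hL hint H hsum
  obtain ⟨Q, hQ, htQ⟩ := exists_isPiece_superset ((hint.mono interior_subset).vadd_set)
    ((Set.vadd_set_subset_add ht).trans hTL) hside
  exact ⟨Q, hQ, t, htQ⟩

end Pieces

/-- The ratio is `l = (m - 1) / (m * n - 1)`. -/
theorem exists_ratio {m n : ℝ} (hm : 1 ≤ m) (hn : 1 < n) :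
    ∃ l : ℝ, 0 ≤ l ∧ l < 1 ∧ ∀ a b : ℝ, (m * n - 1) * b < a →
      (m - 1) * b ≤ l * a ∧ (n - 1) * (l * a + b) < (1 - l) * a := by
  have hN : 0 < m * n - 1 := by nlinarith
  obtain ⟨l, hl⟩ : ∃ l, l * (m * n - 1) = m - 1 := ⟨_, div_mul_cancel₀ _ hN.ne'⟩
  have hl0 : 0 ≤ l := le_of_mul_le_mul_right (by linarith) hN
  have hnl : (1 - n * l) * (m * n - 1) = n - 1 := by linear_combination -n * hl
  have hnl0 : 0 < 1 - n * l := pos_of_mul_pos_left (hnl ▸ sub_pos.2 hn) hN.le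
  refine ⟨l, hl0, by nlinarith, fun a b hab => ⟨?_, ?_⟩⟩
  · rw [← hl, mul_assoc]
    exact mul_le_mul_of_nonneg_left hab.le hl0
  · have := mul_lt_mul_of_pos_left hab hnl0
    rw [← mul_assoc, hnl] at this
    linarith

section Cutting

variable [Nontrivial (E d)] {m n : ℕ}

theorem ofReal_mul_succInradius_le_minRelWidth (hC : IsConvexBody C) (hK : IsConvexBody K)
    (hm : 1 ≤ m) (hs : 0 ≤ s) (h : s ≤ succInradius C K m) :
    ENNReal.ofReal (m * succInradius C K m) ≤ minRelWidth C (roundedBody C K s) := by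
  rw [← minRelWidth_roundedBody_succInradius hC hK hm]
  exact minRelWidth_mono C (roundedBody_anti hC.convex K hs h)

theorem centers_nonempty_of_le_succInradius (hC : IsConvexBody C) (hK : IsConvexBody K)
    (hm : 1 ≤ m) (hs : 0 ≤ s) (h : s ≤ succInradius C K m) : (centers C K s).Nonempty :=
  centers_nonempty_anti hC.convex hC.nonempty hs h (centers_succInradius_nonempty hC hK hm)

theorem isConvexBody_centers_of_lt_succInradius (hC : IsConvexBody C) (hK : IsConvexBody K)
    (hm : 1 ≤ m) (hs : 0 ≤ s) (h : s < succInradius C K m) : IsConvexBody (centers C K s) := by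
  have hm' : (1 : ℝ) ≤ m := by exact_mod_cast hm
  exact isConvexBody_centers hC hK.isCompact hK.convex hs
    (centers_nonempty_of_le_succInradius hC hK hm hs h.le)
    (h.trans_le (le_mul_of_one_le_left (hs.trans h.le) hm'))
    (ofReal_mul_succInradius_le_minRelWidth hC hK hm hs h.le)

theorem mul_realWidth_lt_realWidth_centers (hC : IsConvexBody C) (hK : IsConvexBody K)
    (hm : 1 ≤ m) (hs : 0 ≤ s) (h : s < succInradius C K m) (hu : ‖u‖ = 1) :
    (m - 1) * (s * realWidth C u) < realWidth (centers C K s) u := by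
  have hm0 : (0 : ℝ) < m := by exact_mod_cast hm
  have hne := centers_nonempty_of_le_succInradius hC hK hm hs h.le
  have hle := (ofReal_le_minRelWidth_iff hC
    (isCompact_roundedBody hC.isCompact hC.nonempty hK.isCompact s)
    (roundedBody_nonempty hC.nonempty hne)).1
    (ofReal_mul_succInradius_le_minRelWidth hC hK hm hs h.le) u hu
  rw [realWidth_roundedBody hC.isCompact hC.nonempty hK.isCompact hs hne] at hle
  linarith [mul_lt_mul_of_pos_right (mul_lt_mul_of_pos_left h hm0) (hC.realWidth_pos hu)]

theorem le_succInradius_of_vadd_smul_subset_centers (hC : IsConvexBody C) (hK : IsConvexBody K)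
    (hm : 1 ≤ m) (hs : 0 ≤ s) {T : Set (E d)} (hT : IsCompact T) (hne : T.Nonempty) {t : E d}
    {l : ℝ} (h : t +ᵥ l • T ⊆ centers C K s)
    (hw : ∀ u, ‖u‖ = 1 → (m - 1) * (s * realWidth C u) ≤ l * realWidth T u) :
    s ≤ succInradius C K m := by
  refine le_succInradius hC hK hm ((mem_wideFactors_iff hC hK.isCompact).2
    ⟨hs, hne.smul_set.vadd_set.mono h, fun u hu => ?_⟩)
  rw [mul_assoc]
  exact (hw u hu).trans (mul_realWidth_le_of_vadd_smul_subset
    hT hne (isCompact_centers hC.nonempty hK.isCompact s) h u)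

/-- With `T` the set of centers of the translates of `sC` in `K` and a suitable `l`, Bang's
conjecture provides `t ∈ (1 - l) T` such that `t + l T + sC`, a subset of `K`, lies in a piece. -/
theorem BangConjecture.exists_isPiece_le_succInradius (hB : BangConjecture d)
    (hK : IsConvexBody K) (hC : IsConvexBody C) (hm : 1 ≤ m) (hn : 1 < n)
    (H : Fin (n - 1) → Hyperplane d) (hs : 0 < s) (hlt : s < succInradius C K (m * n)) :
    ∃ Q, IsPiece K H Q ∧ s ≤ succInradius C Q m := by
  have hmn : 1 ≤ m * n := Nat.mul_pos hm hn.le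
  have hT := isConvexBody_centers_of_lt_succInradius hC hK hmn hs.le hlt
  obtain ⟨l, hl0, hl1, hl⟩ :=
    exists_ratio (m := m) (n := n) (by exact_mod_cast hm) (by exact_mod_cast hn)
  replace hl : ∀ u : E d, ‖u‖ = 1 → _ := fun u hu => hl _ _ <| by
    exact_mod_cast mul_realWidth_lt_realWidth_centers hC hK hmn hs.le hlt hu
  set T := centers C K s
  have hlT : IsCompact (l • T) := hT.isCompact.smul l
  have hsC := hC.smul hs
  have hTL : (1 - l) • T + (l • T + s • C) ⊆ K := by
    rw [← add_assoc, ← hT.convex.add_smul (sub_nonneg.2 hl1.le) hl0, sub_add_cancel, one_smul]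
    exact subset_centers_iff.1 subset_rfl
  obtain ⟨Q, hQ, t, ht⟩ := hB.exists_isPiece_vadd_subset (hT.smul (sub_pos.2 hl1))
    (hlT.add hsC.isCompact)
    ((hT.nonempty.smul_set.add hsC.interior_nonempty).mono subset_interior_add_right)
    hTL H fun u hu => by
      rw [realWidth_add hlT hsC.isCompact hT.nonempty.smul_set hsC.nonempty,
        realWidth_smul hT.isCompact hT.nonempty hl0, realWidth_smul hC.isCompact hC.nonempty hs.le,
        realWidth_smul hT.isCompact hT.nonempty (sub_nonneg.2 hl1.le), Nat.cast_pred (by omega)]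
      exact (hl u hu).2
  rw [← vadd_add_assoc] at ht
  exact ⟨Q, hQ, le_succInradius_of_vadd_smul_subset_centers hC (hQ.isConvexBody hK) hm hs.le
    hT.isCompact hT.nonempty (subset_centers_iff.2 ht) fun u hu => (hl u hu).1⟩

theorem exists_slicing_succInradius_le (hK : IsConvexBody K) (hC : IsConvexBody C) (hm : 1 ≤ m)
    (hn : 1 ≤ n) : ∃ H : Fin (n - 1) → Hyperplane d, ∀ Q, IsPiece K H Q →
      succInradius C Q m ≤ succInradius C K (m * n) := by
  have hmn : 1 ≤ m * n := Nat.mul_pos hm hn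
  have hm0 : (0 : ℝ) < m := by exact_mod_cast hm
  have hs := succInradius_pos hC hK hmn
  have hwide := minRelWidth_roundedBody_succInradius hC hK hmn
  have hne := centers_succInradius_nonempty hC hK hmn
  set s := succInradius C K (m * n)
  have hR := isCompact_roundedBody hC.isCompact hC.nonempty hK.isCompact s
  have hRne := roundedBody_nonempty hC.nonempty hne
  obtain ⟨u, hu, hRu⟩ := exists_relWidth_eq_minRelWidth hC hR hRne
  have hCu := hC.realWidth_pos hu
  rw [hwide, relWidth_eq_ofReal hC hR hRne hu, ENNReal.ofReal_eq_ofReal_iff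
    (div_nonneg (realWidth_nonneg hR hRne u) hCu.le) (by positivity), div_eq_iff hCu.ne',
    Nat.cast_mul] at hRu
  refine (exists_slicing_inner_sub_le hR hRne hu (δ := m * s * realWidth C u) (k := n - 1)
    (by positivity) (by rw [hRu, Nat.cast_pred hn]; linarith)).imp fun H hH Q hQ => ?_
  have hQb := hQ.isConvexBody hK
  have hQne := roundedBody_nonempty hC.nonempty (centers_succInradius_nonempty hC hQb hm)
  have hQR := isCompact_roundedBody hC.isCompact hC.nonempty hQb.isCompact (succInradius C Q m)
  have hQw := (ofReal_le_minRelWidth_iff hC hQR hQne).1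
    (minRelWidth_roundedBody_succInradius hC hQb hm).ge u hu
  obtain ⟨q, hq, p, hp, -, e⟩ := exists_realWidth_eq hQR hQne u
  by_contra! hlt
  have hsub : roundedBody C Q (succInradius C Q m) ⊆ roundedBody C K s :=
    (roundedBody_mono C hQ.subset _).trans (roundedBody_anti hC.convex K hs.le hlt.le)
  have hle := hH K Q hQ p ⟨roundedBody_subset _ _ _ hp, hsub hp⟩ q
    ⟨roundedBody_subset _ _ _ hq, hsub hq⟩
  linarith [mul_lt_mul_of_pos_right (mul_lt_mul_of_pos_left hlt hm0) hCu]

theorem BangConjecture.succCut (hB : BangConjecture d) (hm : 1 ≤ m) : SuccCutConjecture d m := by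
  intro K C hK hC n hn
  have hlow : ∀ (H : Fin (n - 1) → Hyperplane d) (ρ : ℝ),
      IsGreatest {r : ℝ | ∃ Q, IsPiece K H Q ∧ r = succInradius C Q m} ρ →
      succInradius C K (m * n) ≤ ρ := by
    intro H ρ hρ
    rcases hn.eq_or_lt with rfl | hn
    · exact hρ.2 ⟨K, (isPiece_fin_zero_iff hK.nonempty H).2 rfl, by rw [mul_one]⟩
    · refine le_of_forall_lt_imp_le_of_dense fun s hs => ?_
      obtain ⟨s', hs', hlt⟩ :=
        exists_between (max_lt hs (succInradius_pos hC hK (Nat.mul_pos hm hn.le)))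
      obtain ⟨Q, hQ, hle⟩ := hB.exists_isPiece_le_succInradius hK hC hm hn H
        ((le_max_right _ _).trans_lt hs') hlt
      exact ((le_max_left _ _).trans hs'.le).trans (hle.trans (hρ.2 ⟨Q, hQ, rfl⟩))
  refine ⟨?_, fun ρ ⟨H, hρ⟩ => hlow H ρ hρ⟩
  obtain ⟨H, hH⟩ := exists_slicing_succInradius_le hK hC hm hn
  obtain ⟨ρ, hρ⟩ := exists_isGreatest_isPiece hK H fun Q => succInradius C Q m
  obtain ⟨Q, hQ, e⟩ := hρ.1
  exact ⟨H, (hlow H ρ hρ).antisymm (e ▸ hH Q hQ) ▸ hρ⟩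

theorem SuccCutConjecture.bodyCut (h : SuccCutConjecture d 1) : BodyCutConjecture d := by
  intro K C hK hC n hn
  have hiff : ∀ (H : Fin (n - 1) → Hyperplane d) (r : ℝ) (Q : Set (E d)),
      (IsPiece K H Q ∧ r = succInradius C Q 1) ↔ (IsPiece K H Q ∧ r = inradius C Q) :=
    fun H r Q => and_congr_right fun hQ => by rw [succInradius_one hC (hQ.isConvexBody hK)]
  simpa only [hiff, one_mul] using h K C hK hC n hn

theorem BodyCutConjecture.alexanderDavenport (h : BodyCutConjecture d) :
    AlexanderDavenportConjecture d := by
  intro C hC n hn H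
  obtain ⟨_, hρ⟩ := exists_isGreatest_isPiece hC H (inradius C)
  have hle := (one_div_le_succInradius_self hC hn).trans ((h C C hC hC n hn).2 ⟨H, hρ⟩)
  obtain ⟨Q, hQ, rfl⟩ := hρ.1
  rw [← succInradius_one hC (hQ.isConvexBody hC)] at hle
  exact ⟨Q, hQ, centers_nonempty_of_le_succInradius hC (hQ.isConvexBody hC) le_rfl
    (by positivity) hle⟩

end Cutting

/-- If a convex body `C` is sliced by `n - 1` hyperplanes, then some piece has minimal `C`-width
at least `1 / n`. This weakening of the Alexander--Davenport conjecture and of all the cutting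
versions still implies Bang's conjecture. -/
def PieceWidthConjecture (d : ℕ) : Prop :=
  ∀ C : Set (E d), IsConvexBody C →
    ∀ n : ℕ, 1 ≤ n → ∀ H : Fin (n - 1) → Hyperplane d,
      ∃ Q, IsPiece C H Q ∧ ENNReal.ofReal (1 / n) ≤ minRelWidth C Q

theorem AlexanderDavenportConjecture.pieceWidth (h : AlexanderDavenportConjecture d) :
    PieceWidthConjecture d := by
  intro C hC n hn H
  obtain ⟨Q, hQ, t, ht⟩ := h C hC n hn H
  exact ⟨Q, hQ, ofReal_le_minRelWidth_of_mem_centers hC (hQ.isConvexBody hC).isCompact ht⟩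

theorem SuccCutConjecture.pieceWidth [Nontrivial (E d)] {m : ℕ} (h : SuccCutConjecture d m)
    (hm : 1 ≤ m) : PieceWidthConjecture d := by
  intro C hC n hn H
  have hm0 : (0 : ℝ) < m := by exact_mod_cast hm
  obtain ⟨_, hρ⟩ := exists_isGreatest_isPiece hC H fun Q => succInradius C Q m
  have hle := (one_div_le_succInradius_self hC (Nat.mul_pos hm hn)).trans
    ((h C C hC hC n hn).2 ⟨H, hρ⟩)
  obtain ⟨Q, hQ, rfl⟩ := hρ.1
  refine ⟨Q, hQ, ?_⟩
  calc ENNReal.ofReal (1 / n) ≤ ENNReal.ofReal (m * succInradius C Q m) := by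
        rw [Nat.cast_mul, ← div_div, div_right_comm, div_le_iff₀' hm0] at hle
        exact ENNReal.ofReal_le_ofReal hle
    _ = minRelWidth C (roundedBody C Q (succInradius C Q m)) :=
        (minRelWidth_roundedBody_succInradius hC (hQ.isConvexBody hC) hm).symm
    _ ≤ minRelWidth C Q := minRelWidth_mono C (roundedBody_subset _ _ _)

theorem exists_levels {lo hi δ : ℝ} {k : ℕ} (hδ : 0 < δ) (hle : lo ≤ hi)
    (hk : hi - lo + δ < k * δ) :
    ∃ ξ : Fin k → ℝ, ∀ p q, p + δ ≤ q → p ≤ hi → lo ≤ q → ∃ j, p < ξ j ∧ ξ j < q := by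
  have hk1 : (0 : ℝ) < k - 1 := pos_of_mul_pos_left (by linarith : 0 < (k - 1) * δ) hδ.le
  obtain ⟨η, hη, hηδ⟩ := exists_between ((div_lt_iff₀' hk1).2 (by linarith : hi - lo < (k - 1) * δ))
  have hη0 : 0 < η := (div_nonneg (sub_nonneg.2 hle) hk1.le).trans_lt hη
  rw [div_lt_iff₀' hk1] at hη
  obtain ⟨b, hb, hb'⟩ := exists_between (show hi - k * η < lo - η by linarith)
  refine ⟨fun j => b + (j + 1) * η, fun p q hpq hp hq => ?_⟩
  obtain ⟨j, hj, hj'⟩ := exists_multiple_between (x := max (p - b) 0) (y := q - b) hη0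
    (le_max_right _ _) (lt_sub_iff_add_lt.1 (max_lt (by linarith) (by linarith)))
    (max_lt (by linarith) (by linarith))
  exact ⟨j, sub_lt_iff_lt_add'.1 ((le_max_left _ _).trans_lt hj), lt_sub_iff_add_lt'.1 hj'⟩

theorem exists_counts {ι : Type*} [Fintype ι] {w : ι → ℝ} (hw : ∀ i, 0 ≤ w i)
    (hsum : ∑ i, w i < 1) :
    ∃ (n : ℕ) (k : ι → ℕ), (∀ i, (n + 1) * w i + 1 < k i) ∧ ∑ i, k i ≤ n := by
  obtain ⟨n, hn⟩ := exists_nat_ge ((1 + 2 * Fintype.card ι) / (1 - ∑ i, w i))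
  rw [div_le_iff₀ (sub_pos.2 hsum)] at hn
  refine ⟨n, fun i => ⌊(n + 1) * w i⌋₊ + 2, fun i => ?_, ?_⟩
  · push_cast
    linarith [Nat.lt_floor_add_one ((n + 1) * w i)]
  · rw [← Nat.cast_le (α := ℝ), Nat.cast_sum]
    calc ∑ i, ((⌊(n + 1) * w i⌋₊ + 2 : ℕ) : ℝ) ≤ ∑ i, ((n + 1) * w i + 2) :=
          Finset.sum_le_sum fun i _ => by
            push_cast
            linarith [Nat.floor_le (mul_nonneg (n.cast_add_one_pos (α := ℝ)).le (hw i))]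
      _ = (n + 1) * ∑ i, w i + Fintype.card ι * 2 := by
        rw [Finset.sum_add_distrib, Finset.mul_sum, Finset.sum_const, Finset.card_univ,
          nsmul_eq_mul]
      _ ≤ n := by linarith

theorem exists_range_subset_range {ι α : Type*} [Fintype ι] [Nonempty α] {n : ℕ}
    (hn : Fintype.card ι ≤ n) (G : ι → α) : ∃ H : Fin n → α, Set.range G ⊆ Set.range H := by
  obtain ⟨φ⟩ : Nonempty (ι ↪ Fin n) :=
    Function.Embedding.nonempty_of_card_le (by rwa [Fintype.card_fin])
  refine ⟨Function.extend φ G fun _ => Classical.arbitrary α, ?_⟩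
  rintro _ ⟨i, rfl⟩
  exact ⟨φ i, φ.injective.extend_apply _ _ _⟩

theorem Plank.exists_slicing_inner_sub_lt {ι : Type*} [Fintype ι] [Nonempty ι] (P : ι → Plank d)
    {δ : ι → ℝ} {k : ι → ℕ} {N : ℕ} (hδ : ∀ i, 0 < δ i)
    (hk : ∀ i, (P i).hi - (P i).lo + δ i < k i * δ i) (hN : ∑ i, k i ≤ N) :
    ∃ H : Fin N → Hyperplane d, ∀ K Q, IsPiece K H Q → ∀ i, ∀ p ∈ Q, ∀ q ∈ Q,
      inner ℝ (P i).normal p ≤ (P i).hi → (P i).lo ≤ inner ℝ (P i).normal q →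
        inner ℝ (P i).normal q - inner ℝ (P i).normal p < δ i := by
  choose ξ hξ using fun i => exists_levels (hδ i) (P i).lo_lt_hi.le (hk i)
  let G : (Σ i, Fin (k i)) → Hyperplane d := fun a =>
    ⟨(P a.1).normal, (P a.1).norm_normal, ξ a.1 a.2⟩
  have : Nonempty (Hyperplane d) :=
    ⟨⟨(P (Classical.arbitrary ι)).normal, (P (Classical.arbitrary ι)).norm_normal, 0⟩⟩
  obtain ⟨H, hGH⟩ := exists_range_subset_range (by simpa using hN) G
  refine ⟨H, fun K Q hQ i p hp q hq hhi hlo => ?_⟩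
  by_contra! hle
  obtain ⟨j, hpj, hjq⟩ := hξ i _ _ (le_sub_iff_add_le'.1 hle) hhi hlo
  obtain ⟨l, hl⟩ := hGH ⟨⟨i, j⟩, rfl⟩
  have hside := hQ.inner_le_offset hq hp (i := l)
  rw [hl] at hside
  exact (hside hpj).not_gt hjq

theorem PieceWidthConjecture.bang (h : PieceWidthConjecture d) : BangConjecture d := by
  intro C hC n P hP
  by_contra! hlt
  let w : Fin n → ℝ := fun i => ((P i).hi - (P i).lo) / realWidth C (P i).normal
  have hC0 : ∀ i, 0 < realWidth C (P i).normal := fun i => hC.realWidth_pos (P i).norm_normal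
  have hw : ∀ i, 0 ≤ w i := fun i => div_nonneg (sub_nonneg.2 (P i).lo_lt_hi.le) (hC0 i).le
  simp only [Plank.relWidth_eq_ofReal hC] at hlt
  rw [← ENNReal.ofReal_sum_of_nonneg fun i _ => hw i, ENNReal.ofReal_lt_one] at hlt
  obtain ⟨N, k, hk, hkN⟩ := exists_counts hw hlt
  let δ : Fin n → ℝ := fun i => 1 / (N + 1 : ℕ) * realWidth C (P i).normal
  have hδ : ∀ i, 0 < δ i := fun i => mul_pos (by positivity) (hC0 i)
  have hkδ : ∀ i, (P i).hi - (P i).lo + δ i < k i * δ i := fun i => by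
    have hwδ : (N + 1) * w i * δ i = (P i).hi - (P i).lo := by
      have := (hC0 i).ne'
      simp only [w, δ]
      push_cast
      field_simp
    linarith [mul_lt_mul_of_pos_right (hk i) (hδ i)]
  obtain ⟨x, hx⟩ := hC.nonempty
  obtain ⟨i₀, -⟩ := Set.mem_iUnion.1 (hP hx)
  have : Nonempty (Fin n) := ⟨i₀⟩
  obtain ⟨H, hH⟩ := Plank.exists_slicing_inner_sub_lt P hδ hkδ hkN
  obtain ⟨Q, hQ, hQw⟩ := h C hC (N + 1) N.succ_pos H
  have hQb := hQ.isConvexBody hC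
  obtain ⟨z, hz⟩ := hQb.nonempty
  obtain ⟨i, hi⟩ := Set.mem_iUnion.1 (hP (hQ.subset hz))
  obtain ⟨p, hp, q, hq, hpq, e⟩ := exists_realWidth_eq hQb.isCompact hQb.nonempty (P i).normal
  have hwide : δ i ≤ realWidth Q (P i).normal :=
    (ofReal_le_minRelWidth_iff hC hQb.isCompact hQb.nonempty).1 hQw _ (P i).norm_normal
  exact (hwide.trans_eq e).not_gt
    (hH C Q hQ i p hp q hq ((hpq z hz).1.trans hi.2) (hi.1.trans (hpq z hz).2))

end PlankInradii

theorem mainTheorem4_general {d : ℕ} (hd : 1 ≤ d) :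
    List.TFAE [
      PlankInradii.BangConjecture d,
      PlankInradii.AlexanderDavenportConjecture d,
      PlankInradii.BodyPlankConjecture d,
      PlankInradii.BodyCutConjecture d,
      ∀ m : ℕ, 1 ≤ m → PlankInradii.SuccPlankConjecture d m,
      ∀ m : ℕ, 1 ≤ m → PlankInradii.SuccPlankWidthConjecture d m,
      ∀ m : ℕ, 1 ≤ m → PlankInradii.SuccCutConjecture d m] ∧
    ∀ m : ℕ, 1 ≤ m → List.TFAE [
      PlankInradii.BangConjecture d,
      PlankInradii.SuccPlankConjecture d m,
      PlankInradii.SuccPlankWidthConjecture d m,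
      PlankInradii.SuccCutConjecture d m] := by
  have : Nonempty (Fin d) := ⟨⟨0, hd⟩⟩
  have : Nontrivial (PlankInradii.E d) := inferInstance
  refine ⟨?_, fun m hm => ?_⟩
  · tfae_have 1 → 3 := fun h => h.bodyPlank
    tfae_have 3 → 6 := fun h m hm => h.succPlankWidth hm
    tfae_have 5 ↔ 6 := forall₂_congr fun m hm => PlankInradii.succPlankConjecture_iff hm
    tfae_have 6 → 7 := fun h m hm => ((h m hm).bang hm).succCut hm
    tfae_have 7 → 4 := fun h => (h 1 le_rfl).bodyCut
    tfae_have 4 → 2 := fun h => h.alexanderDavenport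
    tfae_have 2 → 1 := fun h => h.pieceWidth.bang
    tfae_finish
  · tfae_have 1 → 3 := fun h => h.bodyPlank.succPlankWidth hm
    tfae_have 2 ↔ 3 := PlankInradii.succPlankConjecture_iff hm
    tfae_have 3 → 1 := fun h => h.bang hm
    tfae_have 1 → 4 := fun h => h.succCut hm
    tfae_have 4 → 1 := fun h => (h.pieceWidth hm).bang
    tfae_finish

theorem mainTheorem4 (d : ℕ) (hd : 2 ≤ d) :
    List.TFAE [
      PlankInradii.BangConjecture d,
      PlankInradii.AlexanderDavenportConjecture d,
      PlankInradii.BodyPlankConjecture d,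
      PlankInradii.BodyCutConjecture d,
      ∀ m : ℕ, 1 ≤ m → PlankInradii.SuccPlankConjecture d m,
      ∀ m : ℕ, 1 ≤ m → PlankInradii.SuccPlankWidthConjecture d m,
      ∀ m : ℕ, 1 ≤ m → PlankInradii.SuccCutConjecture d m] ∧
    ∀ m : ℕ, 1 ≤ m →
      (PlankInradii.SuccPlankConjecture d m ↔ PlankInradii.SuccPlankWidthConjecture d m) ∧
      (PlankInradii.SuccPlankConjecture d m → PlankInradii.SuccCutConjecture d m) := by
  obtain ⟨h, hm⟩ := mainTheorem4_general (one_le_two.trans hd)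
  exact ⟨h, fun m h1 => ⟨(hm m h1).out 1 2, ((hm m h1).out 1 3).1⟩⟩
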